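/- Let $n \ge 0$ and let $\mathcal{B}_n$ be the braid arrangement, consisting of the hyperplanes $H_{ij} = \{x \in V \mid x_i = x_j\}$, $1 \le i < j \le n+1$, in the $n$-dimensional space $V = \{x \in \mathbb{R}^{n+1} \mid x_1 + \dots + x_{n+1} = 0\}$. Let $\mathcal{L}$ be its lattice of flats (all intersections of hyperplanes, including $V$ as the empty intersection), ordered by reverse inclusion, with bottom element $V$ and top element $\mathbf{0}$. For flats $X \le Y$ put $\operatorname{Poin}([X,Y];y) = \sum_{X \le Z \le Y} \mu(X,Z)\,(-y)^{\dim X - \dim Z}$, where $\mu$ is the Möbius function of $\mathcal{L}$. The coarse flag Hilbert–Poincaré series and its numerator are defined by \[ \operatorname{cfHP}_{\mathcal{B}_n}(y,t) = \sum_{\mathcal{C}} \Big( \prod_{i=0}^{k} \operatorname{Poin}([C_i,C_{i+1}];y) \Big) \Big(\frac{t}{1-t}\Big)^{k} = \frac{\mathcal{N}_{\mathcal{B}_n}(y,t)}{(1-t)^n}, \] where the sum ranges over all chains $\mathcal{C} = \{C_1 < \dots < C_k\}$ in $\mathcal{L}$ (with $k \ge 0$) that do not contain $V$, and $C_0 =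 V$, $C_{k+1} = \mathbf{0}$. For $w \in \mathfrak{S}_{n+1}$ in one-line notation $w_1 | w_2 | \cdots | w_{n+1}$, with bars numbered $1,\dots,n$ from left to right, and $\sigma \in \operatorname{Sym}(n)$, start with the set composition of $\{1,\dots,n+1\}$ into the singletons $w_1|\cdots|w_{n+1}$ and delete the bars in the order $\sigma(1), \sigma(2), \dots, \sigma(n)$; deleting bar $\sigma(i)$ merges the two consecutive blocks $B_i | B_i'$ adjacent to it into $B_i \cup B_i'$. Let $\operatorname{ino}(w,\sigma)$ be the number of indices $i$ with $\min(B_i) < \min(B_i')$, and let $\lambda(w,\sigma) = (\lambda_1,\dots,\lambda_n)$ with \[ \lambda_i = \varepsilon_i \cdot \max\{\min(B_i), \min(B_i')\}, \] where $\varepsilon_i = 1$ if $\min(B_i) < \min(B_i')$ and $\varepsilon_i = -1$ otherwise. Let $\operatorname{asc}(\lambda(w,\sigma)) = |\{ i \in \{1,\dots,n-1\} \mid \lambda_i < \lambda_{i+1}\}|$. Then \[ \mathcal{N}_{\mathcal{B}_n}(y,t) = \sum_{\substack{w \in \mathfrak{S}_{n+1} \\ \sigma \in \operatorname{Sym}(n)}}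 y^{\operatorname{ino}(w,\sigma)} \cdot t^{\operatorname{asc}(\lambda(w,\sigma))}. \] -/

import Mathlib

noncomputable section

open Finset

/-- A central and essential arrangement of finitely many linear hyperplanes in `V`. -/
structure EssentialArrangement (V : Type*) [AddCommGroup V] [Module ℝ V] where
  /-- the hyperplanes of the arrangement -/
  hyperplanes : Finset (Submodule ℝ V)
  codim_one : ∀ H ∈ hyperplanes, Module.finrank ℝ H + 1 = Module.finrank ℝ V
  essential : hyperplanes.inf id = ⊥

namespace EssentialArrangement

section Flats

variable {V : Type*} [AddCommGroup V] [Module ℝ V]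

/-- A flat of `A`: an intersection of hyperplanes of `A` (the empty intersection is `V`). -/
@[ext]
structure Flat (A : EssentialArrangement V) where
  /-- the underlying subspace -/
  space : Submodule ℝ V
  isInter : ∃ S ⊆ A.hyperplanes, space = S.inf id

variable (A : EssentialArrangement V)

/-- Flats are ordered by reverse inclusion. -/
instance : PartialOrder A.Flat :=
  PartialOrder.lift (fun X => OrderDual.toDual X.space)
    (fun _ _ h => Flat.ext (OrderDual.toDual.injective h))

/-- The bottom element is the whole space `V`. -/
instance : OrderBot A.Flat where
  bot := ⟨⊤, ∅, Finset.empty_subset _, by simp⟩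
  bot_le X := (le_top : X.space ≤ ⊤)

/-- The top element is the zero subspace. -/
instance : OrderTop A.Flat where
  top := ⟨⊥, A.hyperplanes, Finset.Subset.refl _, A.essential.symm⟩
  le_top X := (bot_le : ⊥ ≤ X.space)

instance : Finite A.Flat := by
  classical
  refine Finite.of_surjective
    (fun S : A.hyperplanes.powerset =>
      (⟨S.1.inf id, S.1, Finset.mem_powerset.1 S.2, rfl⟩ : A.Flat)) ?_
  rintro ⟨X, S, hS, rfl⟩
  exact ⟨⟨S, Finset.mem_powerset.2 hS⟩, rfl⟩

instance : Fintype A.Flat := Fintype.ofFinite _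

instance : DecidableEq A.Flat := Classical.decEq _

instance : LocallyFiniteOrder A.Flat := by
  classical
  exact Fintype.toLocallyFiniteOrder

/-- The indeterminate `y` of `ℤ[y, t]`. -/
abbrev y : MvPolynomial (Fin 2) ℤ := MvPolynomial.X 0

/-- The indeterminate `t` of `ℤ[y, t]`. -/
abbrev t : MvPolynomial (Fin 2) ℤ := MvPolynomial.X 1

/-- The Poincaré polynomial `∑ μ(X, Z) (-y) ^ rk(Z)` of the interval `[X, Y]` of the lattice of
flats. Here `Z` runs over `[X, Y]`, and the rank of `Z` in `[X, Y]` is the codimension of `Z`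
in `X`. -/
def poin (X Y : A.Flat) : MvPolynomial (Fin 2) ℤ :=
  ∑ Z ∈ Finset.Icc X Y, MvPolynomial.C (IncidenceAlgebra.mu ℤ X Z) *
    (-y) ^ (Module.finrank ℝ X.space - Module.finrank ℝ Z.space)

/-- A chain `C₁ < ⋯ < Cₖ` of flats together with `C₀ = V` and `Cₖ₊₁ = 0`. -/
def extendedChain {k : ℕ} (c : Fin k ↪o A.Flat) : Fin (k + 2) → A.Flat :=
  Fin.cons ⊥ (Fin.snoc (α := fun _ => A.Flat) c ⊤)

/-- The chain Poincaré polynomial `∏ Poin([Cᵢ, Cᵢ₊₁]; y)`, the product over `0 ≤ i ≤ k`. -/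
def chainPoin {k : ℕ} (c : Fin k ↪o A.Flat) : MvPolynomial (Fin 2) ℤ :=
  ∏ i : Fin (k + 1), A.poin (A.extendedChain c i.castSucc) (A.extendedChain c i.succ)

/-- The field of rational functions in `y` and `t`. -/
abbrev RatField : Type := FractionRing (MvPolynomial (Fin 2) ℤ)

open Classical in
/-- The coarse flag Hilbert–Poincaré series, as a rational function in `y` and `t`. The sum is over
all chains of flats that do not contain `V`; a chain with `k` elements is an order embedding of
`Fin k`, and `k` is at most the number of flats. -/
def cfHP : RatField :=
  ∑ k ∈ Finset.range (Fintype.card A.Flat + 1),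
    ∑ c : Fin k ↪o A.Flat with ∀ i, c i ≠ ⊥,
      algebraMap _ RatField (A.chainPoin c) *
        (algebraMap _ RatField t / (1 - algebraMap _ RatField t)) ^ k

/-- The numerator `N_A(y, t) = (1 - t) ^ n · cfHP_A(y, t)`, where `n = dim V`. -/
def numerator : RatField :=
  (1 - algebraMap _ RatField t) ^ Module.finrank ℝ V * A.cfHP

end Flats

end EssentialArrangement

/-- The space of all `x` in `ℝ^(n+1)` with coordinate sum zero. -/
def braidSpace (n : ℕ) : Submodule ℝ (Fin (n + 1) → ℝ) where
  carrier := {x | ∑ i, x i = 0}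
  add_mem' {a b} ha hb := by
    simp only [Set.mem_ofPred_eq] at ha hb ⊢
    simp [Finset.sum_add_distrib, ha, hb]
  zero_mem' := by simp
  smul_mem' c x hx := by
    simp only [Set.mem_ofPred_eq] at hx ⊢
    simp [← Finset.mul_sum, hx]

/-- The hyperplane `x_i = x_j`, for `i ≠ j`. -/
def braidHyperplane (n : ℕ) (i j : Fin (n + 1)) : Submodule ℝ (braidSpace n) where
  carrier := {x | x.1 i = x.1 j}
  add_mem' {a b} ha hb := by
    simp only [Set.mem_ofPred_eq] at ha hb ⊢
    simp [ha, hb]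
  zero_mem' := by simp
  smul_mem' c x hx := by
    simp only [Set.mem_ofPred_eq] at hx ⊢
    simp [hx]

theorem finrank_braidHyperplane (n : ℕ) {i j : Fin (n + 1)} (hij : i ≠ j) :
    Module.finrank ℝ (braidHyperplane n i j) + 1 = Module.finrank ℝ (braidSpace n) := by
  let f : braidSpace n →ₗ[ℝ] ℝ :=
    (LinearMap.proj (R := ℝ) (φ := fun _ => ℝ) i - LinearMap.proj j) ∘ₗ (braidSpace n).subtype
  have hf : braidHyperplane n i j = LinearMap.ker f := by
    ext x
    simp [braidHyperplane, f, sub_eq_zero]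
  have hne : f ≠ 0 := by
    intro h
    have hmem : (Pi.single i 1 - Pi.single j 1 : Fin (n + 1) → ℝ) ∈ braidSpace n := by
      simp [braidSpace]
    have h1 := LinearMap.congr_fun h ⟨_, hmem⟩
    simp [f, hij, hij.symm] at h1
  rw [hf]
  exact Module.Dual.finrank_ker_add_one_of_ne_zero hne

open Classical in
/-- The braid arrangement `B_n`, consisting of the hyperplanes `x_i = x_j` with `i < j`. -/
def braidArrangement (n : ℕ) : EssentialArrangement (braidSpace n) where
  hyperplanes := (univ.filter fun p : Fin (n + 1) × Fin (n + 1) => p.1 < p.2).image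
    fun p => braidHyperplane n p.1 p.2
  codim_one := by
    intro H hH
    obtain ⟨p, hp, rfl⟩ := Finset.mem_image.1 hH
    exact finrank_braidHyperplane n (ne_of_lt (Finset.mem_filter.1 hp).2)
  essential := by
    rw [eq_bot_iff]
    intro x hx
    rw [Submodule.mem_finsetInf] at hx
    have key : ∀ i, x.1 i = x.1 0 := by
      intro i
      rcases eq_or_ne i 0 with rfl | hi
      · rfl
      · exact (hx (braidHyperplane n 0 i)
          (Finset.mem_image.2 ⟨(0, i), by simpa using Fin.pos_iff_ne_zero.2 hi, rfl⟩)).symm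
    have hs : ∑ i, x.1 i = 0 := x.2
    simp only [key, Finset.sum_const, Finset.card_univ, Fintype.card_fin, nsmul_eq_mul] at hs
    have h0 : x.1 0 = 0 := by
      rcases mul_eq_zero.1 hs with h | h
      · exact absurd h (by positivity)
      · exact h
    rw [Submodule.mem_bot]
    ext i
    simp [key i, h0]

/-! Chains of set compositions. The one-line notation `w_1 | ⋯ | w_{n+1}` has positions
`Fin (n + 1)`, and the bar `b : Fin n` stands between the positions `b.castSucc` and `b.succ`.
Positions, bars and values are counted from `0`; the edge labels below are shifted back so that the
ground set is `{1, …, n + 1}`. -/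

namespace SetComp

/-- The bar `b` separates the positions `p` and `q`. -/
def Separates {n : ℕ} (b : Fin n) (p q : Fin (n + 1)) : Prop :=
  (p ≤ b.castSucc ∧ b.succ ≤ q) ∨ (q ≤ b.castSucc ∧ b.succ ≤ p)

instance {n : ℕ} (b : Fin n) (p q : Fin (n + 1)) : Decidable (Separates b p q) := by
  unfold Separates; infer_instance

/-- The block at position `p` of the set composition that is given by the one-line notation of `w`
with bars at the places `T`: all entries of `w` that no bar in `T` separates from position `p`. -/
def block {n : ℕ} (w : Equiv.Perm (Fin (n + 1))) (T : Finset (Fin n)) (p : Fin (n + 1)) :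
    Finset (Fin (n + 1)) :=
  (univ.filter fun q => ∀ b ∈ T, ¬ Separates b p q).image w

theorem block_nonempty {n : ℕ} (w : Equiv.Perm (Fin (n + 1))) (T : Finset (Fin n))
    (p : Fin (n + 1)) : (block w T p).Nonempty := by
  refine ⟨w p, Finset.mem_image_of_mem _ (Finset.mem_filter.2 ⟨Finset.mem_univ _, ?_⟩)⟩
  rintro b - (⟨h1, h2⟩ | ⟨h1, h2⟩) <;>
    exact absurd (h2.trans h1) (not_le.2 Fin.castSucc_lt_succ)

/-- The bars that are still present just before the `i`-th merging step of the chain of `(w, σ)`,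
in which the bars are deleted in the order `σ(1), …, σ(n)`. -/
def bars {n : ℕ} (σ : Equiv.Perm (Fin n)) (i : Fin n) : Finset (Fin n) :=
  (Finset.Ici i).image σ

/-- The minimum of the block `B` in the `i`-th merging `B | B'` (the block just left of the bar
`σ(i)`). -/
def leftMin {n : ℕ} (w : Equiv.Perm (Fin (n + 1))) (σ : Equiv.Perm (Fin n)) (i : Fin n) :
    Fin (n + 1) :=
  (block w (bars σ i) (σ i).castSucc).min' (block_nonempty _ _ _)

/-- The minimum of the block `B'` in the `i`-th merging `B | B'` (the block just right of the bar
`σ(i)`). -/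
def rightMin {n : ℕ} (w : Equiv.Perm (Fin (n + 1))) (σ : Equiv.Perm (Fin n)) (i : Fin n) :
    Fin (n + 1) :=
  (block w (bars σ i) (σ i).succ).min' (block_nonempty _ _ _)

/-- The number of mergings `B | B'` in the chain of `(w, σ)` with `min B < min B'`. -/
def ino {n : ℕ} (w : Equiv.Perm (Fin (n + 1))) (σ : Equiv.Perm (Fin n)) : ℕ :=
  #{i : Fin n | leftMin w σ i < rightMin w σ i}

/-- The signed edge label `± max (min B) (min B')` of the `i`-th merging `B | B'` in the chain of
`(w, σ)`, with positive sign if and only if `min B < min B'`. -/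
def label {n : ℕ} (w : Equiv.Perm (Fin (n + 1))) (σ : Equiv.Perm (Fin n)) (i : Fin n) : ℤ :=
  (if leftMin w σ i < rightMin w σ i then 1 else -1) *
    (((max (leftMin w σ i) (rightMin w σ i) : Fin (n + 1)) : ℕ) + 1 : ℤ)

/-- The number of ascents `a_i < a_{i+1}` of a finite sequence of integers. -/
def asc {n : ℕ} (a : Fin n → ℤ) : ℕ :=
  #{i : Fin n | ∃ h : (i : ℕ) + 1 < n, a i < a ⟨i + 1, h⟩}

end SetComp

end

/-!
The minimum of each block is recorded for a set partition of `{1, …, n + 1}`, that is, for a flat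
of the braid arrangement (`BraidFlat.rep`). Merging two blocks with minima `a < b` removes `b`
from the set of block minima. Hence a pair `(w, σ)` amounts to a sequence of `n` ordered pairs of
distinct block minima, each pair `(a, b)` labelled by `± max a b`, with sign `+` if and only if `a
< b`. This is proved by induction, contracting the word at the first deleted bar
(`SetComp.sum_weight_eq_mergeSum`).

The Poincaré polynomial of an interval `[X, Y]` is the product of `1 + r_b y` over all block
minima `b` of `X` that are not block minima of `Y`, where `r_b` is the number of block minima of
`X` that are smaller than `b` and in the block of `b` in `Y` (`BraidFlat.poin_eq`). To see this,
expand the product as a sum over functions that send each block minimum of `X` to itself or to a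
smaller one in the same block of `Y`, and group these functions by the flat formed by their trees
(`BraidFlat.sum_Icc_prod_numBelow`). At `y = -1` this is the recursion of the Möbius function, and
for general `y` it gives the polynomial. The same product counts the sequences of mergings from
`X` to `Y` whose labels have no ascent, with `y` marking positive labels: positive labels come
first, in decreasing order, with `r_b` choices for the label `b`, and the negative labels that
follow leave no choice (`BraidFlat.descentSum_eq`, `BraidFlat.descentSum_top`).

With `u = t / (1 - t)`, the sum over chains of flats is therefore a sum over sequences of mergings
that are cut into pieces without ascents, with a factor `u` for each cut. So each ascent carries a
cut and contributes `u`, and any other position contributes `1 + u`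
(`BraidFlat.sum_chainSum_eq_mergeSum`). Multiplication by `(1 - t) ^ n` turns these weights into
`t` and `1`.
-/

/-! ### Sums over chains in a finite poset -/

section ChainSum

variable {P R : Type*} [PartialOrder P] [OrderTop P] [CommRing R]

open Classical in
/-- The sum over all chains `C₁ < ⋯ < Cₖ` above `X` of the product of `f Cᵢ Cᵢ₊₁`, for `0 ≤ i ≤ k`,
times `u ^ k`, where `C₀ = X` and `Cₖ₊₁ = ⊤`; it is defined by recursion on `k`, splitting off
`C₁`. -/
noncomputable def chainSum [Fintype P] (f : P → P → R) (u : R) : ℕ → P → R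
  | 0, X => f X ⊤
  | k + 1, X => ∑ Y : P with X < Y, f X Y * u * chainSum f u k Y

theorem prod_cons_snoc_succ (f : P → P → R) {k : ℕ} (X Y : P) (c : Fin k → P) :
    ∏ i : Fin (k + 2),
      f ((Fin.cons X (Fin.snoc (α := fun _ => P) (Fin.cons Y c : Fin (k + 1) → P) ⊤) :
          Fin (k + 3) → P) i.castSucc)
        ((Fin.cons X (Fin.snoc (α := fun _ => P) (Fin.cons Y c : Fin (k + 1) → P) ⊤) :
          Fin (k + 3) → P) i.succ) =
      f X Y * ∏ i : Fin (k + 1),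
        f ((Fin.cons Y (Fin.snoc (α := fun _ => P) c ⊤) : Fin (k + 2) → P) i.castSucc)
          ((Fin.cons Y (Fin.snoc (α := fun _ => P) c ⊤) : Fin (k + 2) → P) i.succ) := by
  rw [Fin.prod_univ_succ, ← Fin.cons_snoc_eq_snoc_cons]
  rfl

/-- The recursive sum in the form of the definition of the coarse flag Hilbert–Poincaré series. -/
theorem sum_orderEmbedding_eq_chainSum [Fintype P] (f : P → P → R) (u : R) (k : ℕ) (X : P)
    [DecidablePred fun c : Fin k ↪o P => ∀ i, X < c i] :
    ∑ c : Fin k ↪o P with ∀ i, X < c i,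
      (∏ i : Fin (k + 1),
        f ((Fin.cons X (Fin.snoc (α := fun _ => P) c ⊤) : Fin (k + 2) → P) i.castSucc)
          ((Fin.cons X (Fin.snoc (α := fun _ => P) c ⊤) : Fin (k + 2) → P) i.succ)) * u ^ k =
      chainSum f u k X := by
  classical
  induction k generalizing X with
  | zero =>
    rw [Finset.sum_eq_single_of_mem (RelEmbedding.ofIsEmpty _ _ : Fin 0 ↪o P)]
    · simp [chainSum, Fin.snoc]
    · simp
    · intro c _ hc
      exact absurd (RelEmbedding.ext fun i => i.elim0) hc
  | succ k ih =>
    simp only [chainSum, ← ih, Finset.mul_sum]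
    rw [Finset.sum_sigma']
    symm
    have hmono : ∀ (Y : P) (c : Fin k ↪o P), (∀ i, Y < c i) →
        StrictMono (Fin.cons Y c : Fin (k + 1) → P) := by
      intro Y c hc i j hij
      induction i using Fin.cases with
      | zero =>
        induction j using Fin.cases with
        | zero => exact absurd hij (lt_irrefl _)
        | succ j => simpa using hc j
      | succ i =>
        induction j using Fin.cases with
        | zero => exact absurd hij (Fin.not_lt_zero _)
        | succ j => simpa using hij
    refine Finset.sum_bij
      (fun p hp => OrderEmbedding.ofStrictMono (Fin.cons p.1 p.2)
        (hmono p.1 p.2 (by simpa using (Finset.mem_sigma.1 hp).2))) ?_ ?_ ?_ ?_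
    · rintro ⟨Y, c⟩ hp
      simp only [Finset.mem_sigma, Finset.mem_filter, Finset.mem_univ, true_and] at hp ⊢
      intro i
      induction i using Fin.cases with
      | zero => simpa using hp.1
      | succ i => simpa using hp.1.trans (hp.2 i)
    · rintro ⟨Y, c⟩ hp ⟨Y', c'⟩ hp' h
      have h' := congrArg (fun e : Fin (k + 1) ↪o P => (e : Fin (k + 1) → P)) h
      simp only [OrderEmbedding.coe_ofStrictMono] at h'
      obtain ⟨h1, h2⟩ := Fin.cons_injective2 h'
      obtain rfl : Y = Y' := h1
      obtain rfl : c = c' := DFunLike.coe_injective h2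
      rfl
    · intro c hc
      have hc' : ∀ i, X < c i := by simpa using hc
      refine ⟨⟨c 0, OrderEmbedding.ofStrictMono (fun i => c i.succ)
        (fun i j hij => c.strictMono (by simpa using hij))⟩, ?_, ?_⟩
      · simp only [Finset.mem_sigma, Finset.mem_filter, Finset.mem_univ, true_and]
        exact ⟨hc' 0, fun i => c.strictMono (Fin.succ_pos i)⟩
      · ext i
        induction i using Fin.cases with
        | zero => simp
        | succ i => rfl
    · rintro ⟨Y, c⟩ hp
      simp only [OrderEmbedding.coe_ofStrictMono]
      rw [prod_cons_snoc_succ]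
      ring

end ChainSum

namespace EssentialArrangement

variable {V : Type*} [AddCommGroup V] [Module ℝ V] (A : EssentialArrangement V)

/-- The range of the lengths of chains may be extended, since a chain is no longer than the number
of flats. -/
theorem cfHP_eq_sum_chainSum (K : ℕ) (hK : Fintype.card A.Flat < K) :
    A.cfHP = ∑ k ∈ Finset.range K,
      chainSum (fun X Y => algebraMap _ RatField (A.poin X Y))
        (algebraMap _ RatField t / (1 - algebraMap _ RatField t)) k ⊥ := by
  classical
  have hsub : Finset.range (Fintype.card A.Flat + 1) ⊆ Finset.range K :=
    Finset.range_subset_range.2 hK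
  rw [cfHP]
  refine (Finset.sum_congr rfl fun k _ => ?_).trans (Finset.sum_subset hsub fun k _ hk => ?_)
  · rw [← sum_orderEmbedding_eq_chainSum]
    refine Finset.sum_congr ?_ fun c _ => ?_
    · ext c
      simp [bot_lt_iff_ne_bot]
    · rw [chainPoin, map_prod]
      rfl
  · rw [← sum_orderEmbedding_eq_chainSum]
    have : IsEmpty (Fin k ↪o A.Flat) := by
      refine ⟨fun c => hk ?_⟩
      have := Fintype.card_le_of_injective c c.injective
      rw [Fintype.card_fin] at this
      exact Finset.mem_range.2 (Nat.lt_succ_of_le this)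
    exact Finset.sum_eq_zero fun c _ => isEmptyElim c

end EssentialArrangement

/-! ### Flats of the braid arrangement as set partitions -/

namespace BraidFlat

open EssentialArrangement Finset

variable {n : ℕ}

open Classical in
/-- The smallest index in the block of `i`, where two indices are in the same block of the flat `X`
if the corresponding coordinates agree on `X`. -/
noncomputable def rep (X : (braidArrangement n).Flat) (i : Fin (n + 1)) : Fin (n + 1) :=
  (univ.filter fun j => ∀ x ∈ X.space, x.1 j = x.1 i).min' ⟨i, by simp⟩

/-- The block minima of the set partition with the given function from indices to block minima. -/
def fixed (ρ : Fin (n + 1) → Fin (n + 1)) : Finset (Fin (n + 1)) := univ.filter fun i => ρ i = i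

@[simp] theorem mem_fixed {ρ : Fin (n + 1) → Fin (n + 1)} {i : Fin (n + 1)} :
    i ∈ fixed ρ ↔ ρ i = i := by simp [fixed]

variable (X Y : (braidArrangement n).Flat)

theorem rep_le (i : Fin (n + 1)) : rep X i ≤ i :=
  Finset.min'_le _ _ (by simp)

variable {X} in
theorem apply_rep {x : braidSpace n} (hx : x ∈ X.space) (i : Fin (n + 1)) :
    x.1 (rep X i) = x.1 i := by
  classical
  have h := Finset.min'_mem (univ.filter fun j => ∀ x ∈ X.space, x.1 j = x.1 i) ⟨i, by simp⟩
  exact (Finset.mem_filter.1 h).2 x hx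

theorem rep_eq_rep_iff {i j : Fin (n + 1)} :
    rep X i = rep X j ↔ ∀ x ∈ X.space, x.1 i = x.1 j := by
  constructor
  · intro h x hx
    rw [← apply_rep hx i, h, apply_rep hx j]
  · intro h
    unfold rep
    congr 1
    ext k
    simp only [mem_filter, mem_univ, true_and]
    exact forall₂_congr fun x hx => by rw [h x hx]

@[simp] theorem rep_rep (i : Fin (n + 1)) : rep X (rep X i) = rep X i :=
  (rep_eq_rep_iff X).2 fun _ hx => apply_rep hx i

theorem mem_braidArrangement {H : Submodule ℝ (braidSpace n)} :
    H ∈ (braidArrangement n).hyperplanes ↔ ∃ i j, i < j ∧ braidHyperplane n i j = H := by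
  classical
  simp [braidArrangement]

theorem mem_space_iff {x : braidSpace n} :
    x ∈ X.space ↔ ∀ i, x.1 (rep X i) = x.1 i := by
  refine ⟨fun hx i => apply_rep hx i, fun h => ?_⟩
  obtain ⟨S, hS, hX⟩ := X.isInter
  rw [hX, Submodule.mem_finsetInf]
  intro H hH
  obtain ⟨i, j, -, rfl⟩ := mem_braidArrangement.1 (hS hH)
  have hij : rep X i = rep X j := by
    refine (rep_eq_rep_iff X).2 fun z hz => ?_
    rw [hX, Submodule.mem_finsetInf] at hz
    exact hz _ hH
  change x.1 i = x.1 j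
  rw [← h i, hij, h j]

variable {X Y} in
theorem rep_injective (h : rep X = rep Y) : X = Y := by
  refine Flat.ext (Submodule.ext fun x => ?_)
  rw [mem_space_iff, mem_space_iff, h]

theorem le_iff : X ≤ Y ↔ ∀ i, rep Y (rep X i) = rep Y i := by
  constructor
  · intro h i
    have h' : Y.space ≤ X.space := h
    exact (rep_eq_rep_iff Y).2 fun x hx => apply_rep (h' hx) i
  · intro h
    change Y.space ≤ X.space
    intro x hx
    rw [mem_space_iff]
    exact fun i => (rep_eq_rep_iff Y).1 (h i) x hx

variable {X Y} in
theorem fixed_subset (h : X ≤ Y) : fixed (rep Y) ⊆ fixed (rep X) := by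
  intro i hi
  rw [mem_fixed] at hi ⊢
  refine le_antisymm (rep_le X i) ?_
  conv_lhs => rw [← hi, ← (le_iff X Y).1 h i]
  exact rep_le Y _

variable {X Y} in
theorem eq_of_fixed_eq (h : X ≤ Y) (h' : fixed (rep X) = fixed (rep Y)) : X = Y := by
  refine rep_injective (funext fun i => ?_)
  have : rep X i ∈ fixed (rep Y) := by rw [← h']; simp
  rw [mem_fixed, (le_iff X Y).1 h i] at this
  exact this.symm

/-- A vector that is constant on the fibres of `ρ` and takes different values on the fibre of `i`
and on the other fibres. -/
theorem exists_separating (ρ : Fin (n + 1) → Fin (n + 1)) (i : Fin (n + 1)) :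
    ∃ x : braidSpace n, (∀ j k, ρ j = ρ k → x.1 j = x.1 k) ∧ ∀ j, x.1 j = x.1 i → ρ j = ρ i := by
  -- The multiple of the indicator function of the fibre and the constant subtracted from it are
  -- chosen so that the coordinates sum to zero.
  refine ⟨⟨fun k => (if ρ k = ρ i then (n + 1 : ℝ) else 0) - #{k | ρ k = ρ i}, ?_⟩, ?_, ?_⟩
  · change ∑ k, _ = (0 : ℝ)
    rw [Finset.sum_sub_distrib, ← Finset.sum_filter]
    simp
    ring
  · intro j k h
    simp [h]
  · intro j hj
    by_contra hne
    simp only [hne, if_false, if_true] at hj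
    have : (0 : ℝ) < n + 1 := by positivity
    linarith

theorem exists_rep_eq (ρ : Fin (n + 1) → Fin (n + 1)) (hle : ∀ i, ρ i ≤ i)
    (hρ : ∀ i, ρ (ρ i) = ρ i) : ∃ X : (braidArrangement n).Flat, rep X = ρ := by
  classical
  -- All hyperplanes that contain the required flat.
  let S : Finset (Submodule ℝ (braidSpace n)) :=
    (univ.filter fun p : Fin (n + 1) × Fin (n + 1) => p.1 < p.2 ∧ ρ p.1 = ρ p.2).image
      fun p => braidHyperplane n p.1 p.2
  have hS : S ⊆ (braidArrangement n).hyperplanes := by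
    intro H hH
    obtain ⟨p, hp, rfl⟩ := Finset.mem_image.1 hH
    exact mem_braidArrangement.2 ⟨p.1, p.2, (Finset.mem_filter.1 hp).2.1, rfl⟩
  have hmem : ∀ x : braidSpace n, x ∈ S.inf id ↔ ∀ i j, ρ i = ρ j → x.1 i = x.1 j := by
    intro x
    rw [Submodule.mem_finsetInf]
    constructor
    · intro h i j hij
      rcases lt_trichotomy i j with hlt | rfl | hlt
      · exact h (braidHyperplane n i j) (Finset.mem_image.2 ⟨(i, j), by simp [hlt, hij], rfl⟩)
      · rfl
      · exact (h (braidHyperplane n j i)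
          (Finset.mem_image.2 ⟨(j, i), by simp [hlt, hij], rfl⟩)).symm
    · intro h H hH
      obtain ⟨p, hp, rfl⟩ := Finset.mem_image.1 hH
      exact h _ _ (Finset.mem_filter.1 hp).2.2
  let X : (braidArrangement n).Flat := ⟨S.inf id, S, hS, rfl⟩
  have hX : ∀ i j, rep X i = rep X j ↔ ρ i = ρ j := by
    intro i j
    rw [rep_eq_rep_iff]
    constructor
    · intro h
      obtain ⟨x, hx, hx'⟩ := exists_separating ρ j
      exact hx' i (h x ((hmem x).2 hx))
    · intro h x hx
      exact (hmem x).1 hx i j h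
  refine ⟨X, funext fun i => le_antisymm ?_ ?_⟩
  · rw [(hX i (ρ i)).2 (hρ i).symm]
    exact rep_le X _
  · rw [← (hX (rep X i) i).1 (rep_rep X i)]
    exact hle _

@[simp] theorem rep_bot (i : Fin (n + 1)) : rep (⊥ : (braidArrangement n).Flat) i = i := by
  obtain ⟨X, hX⟩ := exists_rep_eq (n := n) (fun i => i) (fun _ => le_rfl) (fun _ => rfl)
  have : X = ⊥ := le_bot_iff.1 ((le_iff X ⊥).2 fun i => by rw [hX])
  rw [← this, hX]

@[simp] theorem rep_top (i : Fin (n + 1)) : rep (⊤ : (braidArrangement n).Flat) i = 0 := by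
  obtain ⟨X, hX⟩ := exists_rep_eq (n := n) (fun _ => 0) (fun _ => Fin.zero_le _) (fun _ => rfl)
  have : X = ⊤ := top_le_iff.1 ((le_iff ⊤ X).2 fun i => by rw [hX])
  rw [← this, hX]

theorem rep_zero : rep X 0 = 0 := le_antisymm (rep_le X 0) (Fin.zero_le _)

theorem zero_mem_fixed : (0 : Fin (n + 1)) ∈ fixed (rep X) := by simp [rep_zero]

theorem card_fixed_pos : 0 < #(fixed (rep X)) := Finset.card_pos.2 ⟨0, zero_mem_fixed X⟩

theorem fixed_top : fixed (rep (⊤ : (braidArrangement n).Flat)) = {0} := by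
  ext i
  simp [eq_comm]

theorem fixed_bot : fixed (rep (⊥ : (braidArrangement n).Flat)) = univ := by
  ext i
  simp

theorem eq_top_iff_card : X = ⊤ ↔ #(fixed (rep X)) = 1 := by
  constructor
  · rintro rfl
    rw [fixed_top, card_singleton]
  · intro h
    refine eq_of_fixed_eq le_top ?_
    obtain ⟨a, ha⟩ := Finset.card_eq_one.1 h
    have h0 := zero_mem_fixed X
    rw [ha, Finset.mem_singleton] at h0
    rw [ha, fixed_top, h0]

variable {X Y} in
theorem card_fixed_lt (h : X < Y) : #(fixed (rep Y)) < #(fixed (rep X)) :=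
  Finset.card_lt_card ((fixed_subset h.le).ssubset_of_ne
    fun h' => h.ne (eq_of_fixed_eq h.le h'.symm))

/-- The restriction to the block minima identifies a flat with the kernel of a nonzero functional,
which weights each coordinate by the size of its block. -/
theorem finrank_space_add_one : Module.finrank ℝ X.space + 1 = #(fixed (rep X)) := by
  classical
  let F := {i // i ∈ fixed (rep X)}
  let toF : Fin (n + 1) → F := fun i => ⟨rep X i, by simp⟩
  let φ : (F → ℝ) →ₗ[ℝ] ℝ := ∑ i : Fin (n + 1), LinearMap.proj (toF i)
  have hφ : ∀ g, φ g = ∑ i, g (toF i) := by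
    intro g
    simp [φ]
  have hne : φ ≠ 0 := by
    intro h
    have h1 := LinearMap.congr_fun h (fun _ => 1)
    rw [hφ] at h1
    simp at h1
    exact absurd h1 (by positivity)
  have htoF : ∀ i : F, toF i.1 = i := fun i => Subtype.ext (mem_fixed.1 i.2)
  let e : X.space ≃ₗ[ℝ] LinearMap.ker φ :=
    { toFun := fun x => ⟨fun i => x.1.1 i.1, by
        rw [LinearMap.mem_ker, hφ]
        have hs : ∑ i, x.1.1 i = 0 := x.1.2
        rw [← hs]
        exact Finset.sum_congr rfl fun i _ => apply_rep x.2 i⟩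
      map_add' := fun x z => rfl
      map_smul' := fun c x => rfl
      invFun := fun g => ⟨⟨fun i => g.1 (toF i), by
          have hg := g.2
          rw [LinearMap.mem_ker, hφ] at hg
          exact hg⟩, by
        rw [mem_space_iff]
        intro i
        change g.1 _ = g.1 _
        exact congrArg g.1 (Subtype.ext (rep_rep X i))⟩
      left_inv := fun x => by
        refine Subtype.ext (Subtype.ext (funext fun i => ?_))
        exact apply_rep x.2 i
      right_inv := fun g => by
        refine Subtype.ext (funext fun i => ?_)
        change g.1 (toF i.1) = g.1 i
        rw [htoF] }
  rw [e.finrank_eq, Module.Dual.finrank_ker_add_one_of_ne_zero hne]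
  simpa [F] using Fintype.card_coe (fixed (rep X))

variable {X Y} in
theorem finrank_sub (h : X ≤ Y) :
    Module.finrank ℝ X.space - Module.finrank ℝ Y.space = #(fixed (rep X) \ fixed (rep Y)) := by
  rw [Finset.card_sdiff_of_subset (fixed_subset h), ← finrank_space_add_one,
    ← finrank_space_add_one]
  omega

/-- Merging the blocks with minima `a` and `b`. -/
theorem exists_merge {a b : Fin (n + 1)} (ha : a ∈ fixed (rep X)) (hb : b ∈ fixed (rep X))
    (hab : a ≠ b) :
    ∃ Z : (braidArrangement n).Flat, fixed (rep Z) = (fixed (rep X)).erase (max a b) ∧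
      ∀ Y, Z ≤ Y ↔ X ≤ Y ∧ rep Y a = rep Y b := by
  rw [mem_fixed] at ha hb
  have hlt : min a b < max a b := min_lt_max.2 hab
  have hmin : rep X (min a b) = min a b := by
    rcases min_choice a b with h | h <;> rw [h] <;> assumption
  have hmax : rep X (max a b) = max a b := by
    rcases max_choice a b with h | h <;> rw [h] <;> assumption
  obtain ⟨Z, hZ⟩ := exists_rep_eq (n := n)
    (fun i => if rep X i = max a b then min a b else rep X i)
    (fun i => by
      split_ifs with h
      · exact (hlt.le.trans h.ge).trans (rep_le X i)
      · exact rep_le X i)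
    (fun i => by
      split_ifs with h h' h'
      · rfl
      · exact hmin
      · rw [rep_rep] at h'
        exact absurd h' h
      · simp)
  have hrel : ∀ Y : (braidArrangement n).Flat,
      rep Y a = rep Y b ↔ rep Y (min a b) = rep Y (max a b) := by
    intro Y
    rcases le_total a b with h | h
    · rw [min_eq_left h, max_eq_right h]
    · rw [min_eq_right h, max_eq_left h, eq_comm]
  refine ⟨Z, ?_, fun Y => ?_⟩
  · ext i
    rw [Finset.mem_erase, mem_fixed, mem_fixed, hZ]
    dsimp only
    split_ifs with h
    · constructor
      · rintro rfl
        rw [hmin] at h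
        exact absurd h hlt.ne
      · rintro ⟨h1, h2⟩
        exact absurd (h2.symm.trans h) h1
    · refine ⟨fun h' => ⟨?_, h'⟩, fun h' => h'.2⟩
      rintro rfl
      exact h h'
  · rw [hrel, le_iff, le_iff, hZ]
    constructor
    · intro h
      have h1 : rep Y (min a b) = rep Y (max a b) := by
        have := h (max a b)
        simpa [hmax] using this
      refine ⟨fun i => ?_, h1⟩
      have := h i
      beta_reduce at this
      split_ifs at this with h2
      · rw [h2, ← h1, this]
      · exact this
    · rintro ⟨h1, h2⟩ i
      dsimp only
      split_ifs with h
      · rw [h2, ← h, h1]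
      · exact h1 i

end BraidFlat

/-! ### Poincaré polynomials of intervals -/

namespace BraidFlat

open EssentialArrangement Finset

variable {n : ℕ}

/-- The number of elements `a < b` of `M` in the block of `b` in the flat `Y`. -/
noncomputable def numBelow (M : Finset (Fin (n + 1))) (Y : (braidArrangement n).Flat)
    (b : Fin (n + 1)) : ℕ :=
  #{a ∈ M | a < b ∧ rep Y a = rep Y b}

theorem numBelow_of_mem_fixed (M : Finset (Fin (n + 1))) {Y : (braidArrangement n).Flat}
    {b : Fin (n + 1)} (hb : b ∈ fixed (rep Y)) : numBelow M Y b = 0 := by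
  rw [mem_fixed] at hb
  refine Finset.card_eq_zero.2 (Finset.filter_eq_empty_iff.2 ?_)
  rintro a - ⟨h1, h2⟩
  rw [hb] at h2
  exact absurd (rep_le Y a) (by rw [h2]; exact not_le.2 h1)

/-- Below the least element `b` of `M` that is not a block minimum, only the minimum of its own
block is available. -/
theorem numBelow_eq_one {M : Finset (Fin (n + 1))} {Y : (braidArrangement n).Flat}
    (hM : fixed (rep Y) ⊆ M) {b : Fin (n + 1)} (hb : b ∈ M \ fixed (rep Y))
    (hmin : ∀ c ∈ M \ fixed (rep Y), b ≤ c) : numBelow M Y b = 1 := by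
  rw [numBelow, Finset.card_eq_one]
  refine ⟨rep Y b, ?_⟩
  ext a
  rw [Finset.mem_filter, Finset.mem_singleton]
  constructor
  · rintro ⟨h1, h2, h3⟩
    have ha : a ∈ fixed (rep Y) := by
      by_contra h
      exact absurd (hmin a (Finset.mem_sdiff.2 ⟨h1, h⟩)) (not_le.2 h2)
    rw [← h3, mem_fixed.1 ha]
  · rintro rfl
    refine ⟨hM (by simp), lt_of_le_of_ne (rep_le Y b) fun h => ?_, by simp⟩
    exact (Finset.mem_sdiff.1 hb).2 (mem_fixed.2 h)

variable (X Y Z : (braidArrangement n).Flat)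

/-- The allowed values at `i` of a parent function for the interval `[X, Y]`: a block minimum of `X`
may choose itself, as a root, or a smaller block minimum of `X` in the same block of `Y`; every
other index must choose the minimum of its block in `X`. -/
noncomputable def parents (i : Fin (n + 1)) : Finset (Fin (n + 1)) :=
  if i ∈ fixed (rep X) then {a ∈ fixed (rep X) | a ≤ i ∧ rep Y a = rep Y i} else {rep X i}

/-- The allowed values at `i` of a parent function whose trees are exactly the blocks of `Z`. -/
noncomputable def treeParents (i : Fin (n + 1)) : Finset (Fin (n + 1)) :=
  if i ∈ fixed (rep Z) then {i}
  else if i ∈ fixed (rep X) then {a ∈ fixed (rep X) | a < i ∧ rep Z a = rep Z i}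
  else {rep X i}

variable {X Y Z}

theorem treeParents_subset (hXZ : X ≤ Z) (hZY : Z ≤ Y) (i : Fin (n + 1)) :
    treeParents X Z i ⊆ parents X Y i := by
  intro a ha
  unfold treeParents at ha
  unfold parents
  split_ifs at ha with h1 h2
  · rw [Finset.mem_singleton] at ha
    subst ha
    have := fixed_subset hXZ h1
    rw [if_pos this]
    exact Finset.mem_filter.2 ⟨this, le_rfl, rfl⟩
  · rw [if_pos h2]
    rw [Finset.mem_filter] at ha ⊢
    refine ⟨ha.1, ha.2.1.le, ?_⟩
    rw [← (le_iff Z Y).1 hZY a, ha.2.2, (le_iff Z Y).1 hZY]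
  · rw [if_neg h2]
    exact ha

theorem eq_self_iff_of_treeParents {p : Fin (n + 1) → Fin (n + 1)}
    (hp : ∀ i, p i ∈ treeParents X Z i) (i : Fin (n + 1)) : p i = i ↔ i ∈ fixed (rep Z) := by
  have h := hp i
  unfold treeParents at h
  split_ifs at h with h1 h2
  · simpa [h1] using h
  · rw [Finset.mem_filter] at h
    simp [h1, h.2.1.ne]
  · rw [Finset.mem_singleton] at h
    rw [mem_fixed, ← h] at h2
    simp [h1, h2]

theorem rep_apply_of_treeParents (hXZ : X ≤ Z) {p : Fin (n + 1) → Fin (n + 1)}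
    (hp : ∀ i, p i ∈ treeParents X Z i) (i : Fin (n + 1)) :
    rep Z (p i) = rep Z i ∧ p i ≤ i := by
  have h := hp i
  unfold treeParents at h
  split_ifs at h with h1 h2
  · rw [Finset.mem_singleton.1 h]
    exact ⟨rfl, le_rfl⟩
  · rw [Finset.mem_filter] at h
    exact ⟨h.2.2, h.2.1.le⟩
  · rw [Finset.mem_singleton.1 h]
    exact ⟨(le_iff X Z).1 hXZ i, rep_le X i⟩

theorem eq_of_treeParents {Z' : (braidArrangement n).Flat} (hXZ : X ≤ Z) (hXZ' : X ≤ Z')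
    {p : Fin (n + 1) → Fin (n + 1)} (hp : ∀ i, p i ∈ treeParents X Z i)
    (hp' : ∀ i, p i ∈ treeParents X Z' i) : Z = Z' := by
  refine rep_injective (funext fun i => ?_)
  induction i using WellFoundedLT.induction with
  | ind i ih =>
    by_cases h : p i = i
    · have h1 := mem_fixed.1 ((eq_self_iff_of_treeParents hp i).1 h)
      have h2 := mem_fixed.1 ((eq_self_iff_of_treeParents hp' i).1 h)
      rw [h1, h2]
    · obtain ⟨h1, h2⟩ := rep_apply_of_treeParents hXZ hp i
      rw [← h1, ih _ (lt_of_le_of_ne h2 h), (rep_apply_of_treeParents hXZ' hp' i).1]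

/-- The trees of a parent function for `[X, Y]` are the blocks of a flat in `[X, Y]`. -/
theorem exists_treeParents (hXY : X ≤ Y) {p : Fin (n + 1) → Fin (n + 1)}
    (hp : ∀ i, p i ∈ parents X Y i) :
    ∃ Z, X ≤ Z ∧ Z ≤ Y ∧ ∀ i, p i ∈ treeParents X Z i := by
  have hfix : ∀ i, i ∈ fixed (rep X) → p i ∈ fixed (rep X) ∧ p i ≤ i ∧ rep Y (p i) = rep Y i := by
    intro i hi
    have h := hp i
    rwa [parents, if_pos hi, Finset.mem_filter] at h
  have hnfix : ∀ i, i ∉ fixed (rep X) → p i = rep X i := by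
    intro i hi
    have h := hp i
    rwa [parents, if_neg hi, Finset.mem_singleton] at h
  have hle : ∀ i, p i ≤ i ∧ rep Y (p i) = rep Y i := by
    intro i
    by_cases hi : i ∈ fixed (rep X)
    · exact (hfix i hi).2
    · rw [hnfix i hi]
      exact ⟨rep_le X i, (le_iff X Y).1 hXY i⟩
  -- A proper parent is smaller, so `k` steps lead from an index `i ≤ k` to the root of its tree.
  have hroot : ∀ k (i : Fin (n + 1)), (i : ℕ) ≤ k → p (p^[k] i) = p^[k] i := by
    intro k
    induction k with
    | zero =>
      intro i hi
      have := (hle i).1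
      exact le_antisymm this (Fin.le_iff_val_le_val.2 (by simp; omega))
    | succ k ih =>
      intro i hi
      by_cases h : p i = i
      · rw [Function.iterate_fixed h, h]
      · rw [Function.iterate_succ_apply]
        refine ih _ ?_
        have : (p i : ℕ) < i := lt_of_le_of_ne (hle i).1 (fun h' => h (Fin.ext h'))
        omega
  have hρp : ∀ i, p (p^[n] i) = p^[n] i := fun i => hroot n i (Nat.lt_succ_iff.1 i.2)
  have hiter : ∀ k i, p^[k] i ≤ i ∧ rep Y (p^[k] i) = rep Y i := by
    intro k
    induction k with
    | zero => exact fun i => ⟨le_rfl, rfl⟩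
    | succ k ih =>
      intro i
      rw [Function.iterate_succ_apply]
      exact ⟨(ih _).1.trans (hle i).1, (ih _).2.trans (hle i).2⟩
  obtain ⟨Z, hZ⟩ := exists_rep_eq (n := n) (p^[n]) (fun i => (hiter n i).1)
    (fun i => Function.iterate_fixed (hρp i) n)
  have hZp : ∀ i, rep Z (p i) = rep Z i := by
    intro i
    rw [hZ, ← Function.iterate_succ_apply, Function.iterate_succ_apply', hρp]
  refine ⟨Z, (le_iff X Z).2 fun i => ?_, (le_iff Z Y).2 fun i => ?_, fun i => ?_⟩
  · by_cases hi : i ∈ fixed (rep X)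
    · rw [mem_fixed.1 hi]
    · rw [← hnfix i hi, hZp]
  · rw [hZ]
    exact (hiter n i).2
  · unfold treeParents
    split_ifs with h1 h2
    · rw [Finset.mem_singleton]
      rw [mem_fixed, hZ] at h1
      conv_lhs => rw [← h1]
      rw [hρp, h1]
    · obtain ⟨h3, h4, -⟩ := hfix i h2
      refine Finset.mem_filter.2 ⟨h3, lt_of_le_of_ne h4 fun h => h1 ?_, hZp i⟩
      rw [mem_fixed, hZ]
      exact Function.iterate_fixed h n
    · rw [Finset.mem_singleton]
      exact hnfix i h2

section Sum

variable {R : Type*} [CommRing R] (y : R)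

theorem prod_sum_parents :
    ∏ i, ∑ a ∈ parents X Y i, (if i ∈ fixed (rep X) ∧ a ≠ i then y else 1) =
      ∏ b ∈ fixed (rep X) \ fixed (rep Y), (1 + numBelow (fixed (rep X)) Y b * y) := by
  have hfix : ∀ b ∈ fixed (rep X),
      ∑ a ∈ parents X Y b, (if b ∈ fixed (rep X) ∧ a ≠ b then y else 1) =
        1 + numBelow (fixed (rep X)) Y b * y := by
    intro b hb
    have hins : parents X Y b =
        insert b {a ∈ fixed (rep X) | a < b ∧ rep Y a = rep Y b} := by
      ext a
      rw [parents, if_pos hb, Finset.mem_insert, Finset.mem_filter, Finset.mem_filter]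
      rcases eq_or_ne a b with rfl | hne
      · simp [mem_fixed.1 hb]
      · simp [hne, lt_iff_le_and_ne]
    rw [hins, Finset.sum_insert (by simp), numBelow, Finset.card_eq_sum_ones, Nat.cast_sum,
      Finset.sum_mul]
    congr 1
    · simp
    · refine Finset.sum_congr rfl fun a ha => ?_
      rw [if_pos ⟨hb, (Finset.mem_filter.1 ha).2.1.ne⟩]
      simp
  symm
  refine Finset.prod_subset_one_on_sdiff (Finset.subset_univ _) ?_ ?_
  · intro i hi
    by_cases h : i ∈ fixed (rep X)
    · have h' : i ∈ fixed (rep Y) := by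
        by_contra h'
        simp [h, h'] at hi
      rw [hfix i h, numBelow_of_mem_fixed _ h']
      simp
    · rw [parents, if_neg h]
      simp [h]
  · intro b hb
    exact (hfix b (Finset.mem_sdiff.1 hb).1).symm

theorem prod_sum_treeParents :
    ∏ i, ∑ a ∈ treeParents X Z i, (if i ∈ fixed (rep X) ∧ a ≠ i then y else 1) =
      ∏ b ∈ fixed (rep X) \ fixed (rep Z), (numBelow (fixed (rep X)) Z b * y) := by
  symm
  refine Finset.prod_subset_one_on_sdiff (Finset.subset_univ _) ?_ ?_
  · intro i hi
    unfold treeParents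
    split_ifs with h1 h2
    · simp
    · simp [h1, h2] at hi
    · simp [h2]
  · intro b hb
    rw [Finset.mem_sdiff] at hb
    rw [treeParents, if_neg hb.2, if_pos hb.1, numBelow, Finset.card_filter, Nat.cast_sum,
      Finset.sum_mul, Finset.sum_filter]
    refine Finset.sum_congr rfl fun a _ => ?_
    split_ifs with h1 h2
    · simp
    · exact absurd ⟨hb.1, h1.1.ne⟩ h2
    · simp

/-- Summing over parent functions for `[X, Y]`, grouped by the flat whose blocks are their trees. -/
theorem sum_Icc_prod_numBelow (hXY : X ≤ Y) :
    ∑ Z ∈ Finset.Icc X Y, ∏ b ∈ fixed (rep X) \ fixed (rep Z),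
        (numBelow (fixed (rep X)) Z b * y) =
      ∏ b ∈ fixed (rep X) \ fixed (rep Y), (1 + numBelow (fixed (rep X)) Y b * y) := by
  have hunion : Fintype.piFinset (parents X Y) =
      (Finset.Icc X Y).biUnion fun Z => Fintype.piFinset (treeParents X Z) := by
    ext p
    simp only [Finset.mem_biUnion, Fintype.mem_piFinset, Finset.mem_Icc]
    constructor
    · intro hp
      obtain ⟨Z, h1, h2, h3⟩ := exists_treeParents hXY hp
      exact ⟨Z, ⟨h1, h2⟩, h3⟩
    · rintro ⟨Z, ⟨h1, h2⟩, h3⟩ i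
      exact treeParents_subset h1 h2 i (h3 i)
  rw [← prod_sum_parents, Finset.prod_univ_sum, hunion, Finset.sum_biUnion]
  · refine Finset.sum_congr rfl fun Z _ => ?_
    rw [← prod_sum_treeParents y, Finset.prod_univ_sum]
  · intro Z hZ Z' hZ' hne
    refine Finset.disjoint_left.2 fun p hp hp' => hne ?_
    rw [Fintype.mem_piFinset] at hp hp'
    exact eq_of_treeParents (Finset.mem_Icc.1 hZ).1 (Finset.mem_Icc.1 hZ').1 hp hp'

end Sum

/-- The recursion of the Möbius function is the identity `sum_Icc_prod_numBelow` at `y = -1`. -/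
theorem mu_eq (hXZ : X ≤ Z) : IncidenceAlgebra.mu ℤ X Z =
    ∏ b ∈ fixed (rep X) \ fixed (rep Z), (numBelow (fixed (rep X)) Z b * (-1 : ℤ)) := by
  induction Z using WellFoundedLT.induction with
  | ind Z ih =>
    rcases eq_or_ne X Z with rfl | hne
    · simp
    · have h := sum_Icc_prod_numBelow (-1 : ℤ) hXZ
      have hnonempty : (fixed (rep X) \ fixed (rep Z)).Nonempty := by
        rw [Finset.sdiff_nonempty]
        exact fun h => hne (eq_of_fixed_eq hXZ (h.antisymm (fixed_subset hXZ)))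
      -- Setting `y = -1` kills the factor of the least index that is not a block minimum of `Z`.
      have hzero : ∏ b ∈ fixed (rep X) \ fixed (rep Z),
          (1 + numBelow (fixed (rep X)) Z b * (-1 : ℤ)) = 0 := by
        refine Finset.prod_eq_zero (Finset.min'_mem _ hnonempty) ?_
        rw [numBelow_eq_one (fixed_subset hXZ) (Finset.min'_mem _ hnonempty)
          fun c hc => Finset.min'_le _ c hc]
        simp
      rw [hzero, ← Finset.Ico_insert_right hXZ, Finset.sum_insert (by simp)] at h
      rw [IncidenceAlgebra.mu_eq_neg_sum_Ico_of_ne hne, eq_comm, eq_neg_iff_add_eq_zero, ← h]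
      congr 1
      refine Finset.sum_congr rfl fun W hW => ?_
      rw [Finset.mem_Ico] at hW
      exact ih W hW.2 hW.1

theorem poin_eq (hXY : X ≤ Y) : (braidArrangement n).poin X Y =
    ∏ b ∈ fixed (rep X) \ fixed (rep Y),
      (1 + numBelow (fixed (rep X)) Y b * EssentialArrangement.y) := by
  rw [← sum_Icc_prod_numBelow _ hXY, poin]
  refine Finset.sum_congr rfl fun Z hZ => ?_
  have hXZ := (Finset.mem_Icc.1 hZ).1
  rw [mu_eq hXZ, finrank_sub hXZ, map_prod, ← Finset.prod_const, ← Finset.prod_mul_distrib]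
  refine Finset.prod_congr rfl fun b _ => ?_
  simp

end BraidFlat

/-! ### Sequences of mergings weighted by ascents -/

namespace BraidFlat

open EssentialArrangement Finset

variable {n : ℕ} {R : Type*} [CommRing R]

/-- The label of the merging `B | B'` of blocks with minima `q.1` and `q.2`. -/
def signedLabel (q : Fin (n + 1) × Fin (n + 1)) : ℤ :=
  (if q.1 < q.2 then 1 else -1) * (((max q.1 q.2 : Fin (n + 1)) : ℕ) + 1 : ℤ)

theorem signedLabel_of_lt {a b : Fin (n + 1)} (h : a < b) :
    signedLabel (a, b) = ((b : ℕ) : ℤ) + 1 := by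
  simp [signedLabel, h, max_eq_right h.le]

theorem signedLabel_of_gt {a b : Fin (n + 1)} (h : a < b) :
    signedLabel (b, a) = -(((b : ℕ) : ℤ) + 1) := by
  simp [signedLabel, h.not_gt, max_eq_left h.le]

/-- The sum over all sequences of `m` mergings of blocks with set of minima `M`. A merging
contributes `y` if its label is positive, and `α` or `β` according to whether its label is larger
than the preceding one or not; the label before the first one is taken to be `ℓ`. -/
def mergeSum (y α β : R) : ℕ → ℤ → Finset (Fin (n + 1)) → R
  | 0, _, _ => 1
  | m + 1, ℓ, M => ∑ q ∈ M.offDiag, (if q.1 < q.2 then y else 1) *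
      ((if ℓ < signedLabel q then α else β) *
        mergeSum y α β m (signedLabel q) (M.erase (max q.1 q.2)))

theorem mergeSum_mul (y α β c : R) (m : ℕ) (ℓ : ℤ) (M : Finset (Fin (n + 1))) :
    mergeSum y (c * α) (c * β) m ℓ M = c ^ m * mergeSum y α β m ℓ M := by
  induction m generalizing ℓ M with
  | zero => simp [mergeSum]
  | succ m ih =>
    simp only [mergeSum, ih, Finset.mul_sum]
    refine Finset.sum_congr rfl fun q _ => ?_
    split_ifs <;> ring

theorem map_mergeSum {S : Type*} [CommRing S] (φ : R →+* S) (y α β : R) (m : ℕ) (ℓ : ℤ)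
    (M : Finset (Fin (n + 1))) :
    φ (mergeSum y α β m ℓ M) = mergeSum (φ y) (φ α) (φ β) m ℓ M := by
  induction m generalizing ℓ M with
  | zero => simp [mergeSum]
  | succ m ih =>
    simp only [mergeSum, ← ih, map_sum, map_mul, apply_ite φ, map_one]

/-- The sum of `y` to the number of positive labels over all sequences of mergings without ascents
that lead from the blocks with set of minima `M` to the blocks of the flat `Y`, where the label
before the first one is `ℓ`. In such a sequence the positive labels come first, in decreasing order,
and each allows `numBelow` many mergings; the negative labels follow with increasing absolute
values, and each allows one merging. -/
noncomputable def descentSum (y : R) (ℓ : ℤ) (M : Finset (Fin (n + 1)))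
    (Y : (braidArrangement n).Flat) : R :=
  ∏ b ∈ M \ fixed (rep Y), ((if -(((b : ℕ) : ℤ) + 1) ≤ ℓ then 1 else 0) +
    (if ((b : ℕ) : ℤ) + 1 ≤ ℓ then numBelow M Y b * y else 0))

theorem sum_offDiag_eq {α : Type*} [LinearOrder α] (M : Finset α) (g : α × α → R) :
    ∑ q ∈ M.offDiag, g q = ∑ b ∈ M, ∑ a ∈ M with a < b, (g (a, b) + g (b, a)) := by
  have h1 : ∑ q ∈ M.offDiag, g q =
      ∑ a ∈ M, ∑ b ∈ M, ((if a < b then g (a, b) else 0) + if b < a then g (a, b) else 0) := by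
    have hoff : M.offDiag = (M ×ˢ M).filter fun q => q.1 ≠ q.2 := by
      ext q
      simp [Finset.mem_offDiag, and_assoc]
    rw [hoff, Finset.sum_filter, Finset.sum_product]
    refine Finset.sum_congr rfl fun a _ => Finset.sum_congr rfl fun b _ => ?_
    rcases lt_trichotomy a b with h | rfl | h
    · simp [h, h.ne, h.not_gt]
    · simp
    · simp [h, h.ne', h.not_gt]
  have h2 : ∑ a ∈ M, ∑ b ∈ M, (if a < b then g (a, b) else 0) =
      ∑ b ∈ M, ∑ a ∈ M, (if a < b then g (a, b) else 0) := Finset.sum_comm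
  simp only [Finset.sum_add_distrib] at h1
  rw [h1, h2, ← Finset.sum_add_distrib]
  simp only [Finset.sum_filter, ← Finset.sum_add_distrib]
  refine Finset.sum_congr rfl fun b _ => Finset.sum_congr rfl fun a _ => ?_
  split_ifs <;> simp

section Descent

variable (y : R) {M : Finset (Fin (n + 1))} {Y : (braidArrangement n).Flat} {b : Fin (n + 1)}

theorem numBelow_erase {c : Fin (n + 1)} (h : c ≤ b) :
    numBelow (M.erase b) Y c = numBelow M Y c := by
  unfold numBelow
  congr 1
  ext a
  simp only [Finset.mem_filter, Finset.mem_erase]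
  constructor
  · rintro ⟨⟨-, h1⟩, h2⟩
    exact ⟨h1, h2⟩
  · rintro ⟨h1, h2⟩
    exact ⟨⟨(h2.1.trans_le h).ne, h1⟩, h2⟩

theorem descentSum_erase_pos :
    descentSum y (((b : ℕ) : ℤ) + 1) (M.erase b) Y =
      ∏ c ∈ M \ fixed (rep Y) with c < b, (1 + numBelow M Y c * y) := by
  classical
  rw [descentSum, Finset.erase_sdiff_comm, Finset.prod_filter]
  rw [← Finset.prod_erase (a := b) (M \ fixed (rep Y)) (by simp)]
  refine Finset.prod_congr rfl fun c hc => ?_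
  have hne := Finset.ne_of_mem_erase hc
  have h1 : -(((c : ℕ) : ℤ) + 1) ≤ ((b : ℕ) : ℤ) + 1 := by omega
  rw [if_pos h1]
  by_cases h : c < b
  · have h2 : ((c : ℕ) : ℤ) + 1 ≤ ((b : ℕ) : ℤ) + 1 := by
      have : (c : ℕ) < b := h
      omega
    rw [if_pos h, if_pos h2, numBelow_erase h.le]
  · have h2 : ¬ ((c : ℕ) : ℤ) + 1 ≤ ((b : ℕ) : ℤ) + 1 := by
      have : (b : ℕ) < c := lt_of_le_of_ne (not_lt.1 h) fun h' => hne (Fin.ext h'.symm)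
      omega
    rw [if_neg h, if_neg h2, add_zero]

theorem descentSum_erase_neg :
    descentSum y (-(((b : ℕ) : ℤ) + 1)) (M.erase b) Y =
      if ∀ c ∈ M \ fixed (rep Y), b ≤ c then 1 else 0 := by
  have h : ∀ c ∈ (M \ fixed (rep Y)).erase b,
      ((if -(((c : ℕ) : ℤ) + 1) ≤ -(((b : ℕ) : ℤ) + 1) then 1 else 0) +
        (if ((c : ℕ) : ℤ) + 1 ≤ -(((b : ℕ) : ℤ) + 1) then numBelow (M.erase b) Y c * y else 0)) =
      if b ≤ c then (1 : R) else 0 := by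
    intro c _
    have h1 : ¬ ((c : ℕ) : ℤ) + 1 ≤ -(((b : ℕ) : ℤ) + 1) := by omega
    have h2 : -(((c : ℕ) : ℤ) + 1) ≤ -(((b : ℕ) : ℤ) + 1) ↔ b ≤ c := by
      rw [Fin.le_iff_val_le_val]
      omega
    rw [if_neg h1, add_zero]
    simp only [h2]
  rw [descentSum, Finset.erase_sdiff_comm, Finset.prod_congr rfl h, Finset.prod_ite_zero,
    Finset.prod_const_one]
  congr 1
  refine propext ⟨fun h c hc => ?_, fun h c hc => h c (Finset.mem_of_mem_erase hc)⟩
  rcases eq_or_ne c b with rfl | hne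
  · exact le_rfl
  · exact h c (Finset.mem_erase.2 ⟨hne, hc⟩)

/-- Only the least element that is not a block minimum can carry the first label, if all labels are
negative. -/
theorem prod_neg_le (ℓ : ℤ) (hM : fixed (rep Y) ⊆ M) :
    ∏ b ∈ M \ fixed (rep Y), (if -(((b : ℕ) : ℤ) + 1) ≤ ℓ then (1 : R) else 0) =
      (if M = fixed (rep Y) then 1 else 0) + ∑ b ∈ M \ fixed (rep Y), numBelow M Y b *
        (if -(((b : ℕ) : ℤ) + 1) ≤ ℓ then
          descentSum y (-(((b : ℕ) : ℤ) + 1)) (M.erase b) Y else 0) := by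
  rcases (M \ fixed (rep Y)).eq_empty_or_nonempty with h | h
  · rw [h, if_pos ((Finset.sdiff_eq_empty_iff_subset.1 h).antisymm hM)]
    simp
  · have hne : M ≠ fixed (rep Y) := by
      rintro h'
      rw [← h', Finset.sdiff_self] at h
      exact Finset.not_nonempty_empty h
    set b := (M \ fixed (rep Y)).min' h with hb
    have hbS : b ∈ M \ fixed (rep Y) := Finset.min'_mem _ h
    have hmin : ∀ c ∈ M \ fixed (rep Y), b ≤ c := fun c hc => Finset.min'_le _ c hc
    rw [if_neg hne, zero_add, Finset.sum_eq_single_of_mem b hbS, numBelow_eq_one hM hbS hmin,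
      descentSum_erase_neg, if_pos hmin, Finset.prod_ite_zero, Finset.prod_const_one, Nat.cast_one,
      one_mul]
    · congr 1
      refine propext ⟨fun h' => h' b hbS, fun h' c hc => ?_⟩
      have : (b : ℕ) ≤ c := hmin c hc
      omega
    · intro c hc hcb
      have hnot : ¬ ∀ d ∈ M \ fixed (rep Y), c ≤ d :=
        fun h' => hcb (le_antisymm (h' b hbS) (hmin c hc))
      rw [descentSum_erase_neg, if_neg hnot]
      simp

/-- Splitting off the first merging of a sequence without ascents. -/
theorem descentSum_eq (ℓ : ℤ) (hM : fixed (rep Y) ⊆ M) :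
    descentSum y ℓ M Y = (if M = fixed (rep Y) then 1 else 0) +
      ∑ q ∈ M.offDiag, if rep Y q.1 = rep Y q.2 ∧ signedLabel q ≤ ℓ then
        (if q.1 < q.2 then y else 1) *
          descentSum y (signedLabel q) (M.erase (max q.1 q.2)) Y else 0 := by
  have hsum : ∑ q ∈ M.offDiag, (if rep Y q.1 = rep Y q.2 ∧ signedLabel q ≤ ℓ then
        (if q.1 < q.2 then y else 1) *
          descentSum y (signedLabel q) (M.erase (max q.1 q.2)) Y else 0) =
      ∑ b ∈ M \ fixed (rep Y), numBelow M Y b *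
        ((if ((b : ℕ) : ℤ) + 1 ≤ ℓ then
          y * descentSum y (((b : ℕ) : ℤ) + 1) (M.erase b) Y else 0) +
        if -(((b : ℕ) : ℤ) + 1) ≤ ℓ then
          descentSum y (-(((b : ℕ) : ℤ) + 1)) (M.erase b) Y else 0) := by
    rw [sum_offDiag_eq]
    have hinner : ∀ b ∈ M, ∑ a ∈ M with a < b, ((if rep Y a = rep Y b ∧ signedLabel (a, b) ≤ ℓ then
          (if a < b then y else 1) *
            descentSum y (signedLabel (a, b)) (M.erase (max a b)) Y else 0) +
          if rep Y b = rep Y a ∧ signedLabel (b, a) ≤ ℓ then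
          (if b < a then y else 1) *
            descentSum y (signedLabel (b, a)) (M.erase (max b a)) Y else 0) =
        numBelow M Y b * ((if ((b : ℕ) : ℤ) + 1 ≤ ℓ then
          y * descentSum y (((b : ℕ) : ℤ) + 1) (M.erase b) Y else 0) +
        if -(((b : ℕ) : ℤ) + 1) ≤ ℓ then
          descentSum y (-(((b : ℕ) : ℤ) + 1)) (M.erase b) Y else 0) := by
      intro b _
      rw [numBelow, ← Finset.filter_filter, Finset.natCast_card_filter, Finset.sum_mul]
      refine Finset.sum_congr rfl fun a ha => ?_
      have hab : a < b := (Finset.mem_filter.1 ha).2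
      rw [signedLabel_of_lt hab, signedLabel_of_gt hab, max_eq_right hab.le, max_eq_left hab.le,
        if_pos hab, if_neg hab.not_gt, one_mul]
      by_cases h : rep Y a = rep Y b
      · simp [h]
      · simp [h, Ne.symm h]
    rw [Finset.sum_congr rfl hinner]
    refine (Finset.sum_subset Finset.sdiff_subset fun b hb hb' => ?_).symm
    have hbY : b ∈ fixed (rep Y) := by
      by_contra h
      exact hb' (Finset.mem_sdiff.2 ⟨hb, h⟩)
    rw [numBelow_of_mem_fixed M hbY, Nat.cast_zero, zero_mul]
  rw [hsum, descentSum, Finset.prod_add_ordered, prod_neg_le y ℓ hM]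
  simp only [mul_add, Finset.sum_add_distrib]
  rw [add_assoc, add_comm (∑ b ∈ M \ fixed (rep Y), numBelow M Y b *
        (if ((b : ℕ) : ℤ) + 1 ≤ ℓ then
          y * descentSum y (((b : ℕ) : ℤ) + 1) (M.erase b) Y else 0))]
  congr 2
  refine Finset.sum_congr rfl fun b _ => ?_
  split_ifs with hb
  · rw [descentSum_erase_pos]
    have h1 : ∀ c ∈ (M \ fixed (rep Y)).filter (b < ·),
        (if -(((c : ℕ) : ℤ) + 1) ≤ ℓ then (1 : R) else 0) = 1 := by
      intro c _
      exact if_pos (by omega)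
    have h2 : ∀ c ∈ (M \ fixed (rep Y)).filter (· < b),
        ((if -(((c : ℕ) : ℤ) + 1) ≤ ℓ then (1 : R) else 0) +
          (if ((c : ℕ) : ℤ) + 1 ≤ ℓ then numBelow M Y c * y else 0)) =
        1 + numBelow M Y c * y := by
      intro c hc
      have : (c : ℕ) < b := (Finset.mem_filter.1 hc).2
      rw [if_pos (by omega), if_pos (by omega)]
    rw [Finset.prod_congr rfl h1, Finset.prod_congr rfl h2, Finset.prod_const_one]
    ring
  · simp

theorem descentSum_top (M : Finset (Fin (n + 1))) (Y : (braidArrangement n).Flat) :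
    descentSum y (n + 1) M Y = ∏ b ∈ M \ fixed (rep Y), (1 + numBelow M Y b * y) := by
  refine Finset.prod_congr rfl fun b _ => ?_
  have := b.2
  rw [if_pos (by omega), if_pos (by omega)]

theorem descentSum_self (ℓ : ℤ) (X : (braidArrangement n).Flat) :
    descentSum y ℓ (fixed (rep X)) X = 1 := by
  simp [descentSum]

end Descent

theorem neg_lt_signedLabel (q : Fin (n + 1) × Fin (n + 1)) : -(n + 2 : ℤ) < signedLabel q := by
  have := (max q.1 q.2).2
  unfold signedLabel
  split_ifs <;> omega

theorem signedLabel_le (q : Fin (n + 1) × Fin (n + 1)) : signedLabel q ≤ (n + 1 : ℤ) := by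
  have := (max q.1 q.2).2
  unfold signedLabel
  split_ifs <;> omega

section Decomposition

variable (y u : R)

/-- Splitting a sequence of mergings at its first cut. An ascent has weight `u` because a cut, of
weight `u`, is forced there; any other position has weight `1 + u` because a cut is optional. The
mergings before the first cut, at the flat `Y`, have no ascents. The number `-(n + 2)` is smaller
than every label, so that the remaining sequence starts with a forced cut. -/
theorem mergeSum_eq_sum_descentSum (m : ℕ) (ℓ : ℤ) (X : (braidArrangement n).Flat)
    [DecidablePred (X ≤ ·)] (hm : #(fixed (rep X)) = m + 1) :
    mergeSum y u (1 + u) m ℓ (fixed (rep X)) =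
      ∑ Y with X ≤ Y, descentSum y ℓ (fixed (rep X)) Y *
        mergeSum y u (1 + u) (#(fixed (rep Y)) - 1) (-(n + 2)) (fixed (rep Y)) := by
  classical
  induction m generalizing ℓ X with
  | zero =>
    have hX : X = ⊤ := (eq_top_iff_card X).2 hm
    subst hX
    rw [Finset.sum_eq_single_of_mem ⊤ (by simp)]
    · rw [descentSum_self, hm]
      simp [mergeSum]
    · intro Y hY hne
      exact absurd (top_le_iff.1 (Finset.mem_filter.1 hY).2) hne
  | succ m ih =>
    -- The first merging either follows a cut or is not an ascent.
    have hsplit : mergeSum y u (1 + u) (m + 1) ℓ (fixed (rep X)) =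
        mergeSum y u (1 + u) (m + 1) (-(n + 2)) (fixed (rep X)) +
          ∑ q ∈ (fixed (rep X)).offDiag, if signedLabel q ≤ ℓ then (if q.1 < q.2 then y else 1) *
            mergeSum y u (1 + u) m (signedLabel q) ((fixed (rep X)).erase (max q.1 q.2))
          else 0 := by
      simp only [mergeSum, neg_lt_signedLabel, if_true, ← Finset.sum_add_distrib]
      refine Finset.sum_congr rfl fun q _ => ?_
      by_cases h : signedLabel q ≤ ℓ
      · rw [if_neg (not_lt.2 h), if_pos h]
        ring
      · rw [if_pos (not_le.1 h), if_neg h, add_zero]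
    have hexp : ∀ Y ∈ (univ.filter (X ≤ ·) : Finset (braidArrangement n).Flat),
        descentSum y ℓ (fixed (rep X)) Y *
          mergeSum y u (1 + u) (#(fixed (rep Y)) - 1) (-(n + 2)) (fixed (rep Y)) =
        (if Y = X then mergeSum y u (1 + u) (m + 1) (-(n + 2)) (fixed (rep X)) else 0) +
        ∑ q ∈ (fixed (rep X)).offDiag, if rep Y q.1 = rep Y q.2 ∧ signedLabel q ≤ ℓ then
          (if q.1 < q.2 then y else 1) *
          (descentSum y (signedLabel q) ((fixed (rep X)).erase (max q.1 q.2)) Y *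
            mergeSum y u (1 + u) (#(fixed (rep Y)) - 1) (-(n + 2)) (fixed (rep Y))) else 0 := by
      intro Y hY
      have hXY := (Finset.mem_filter.1 hY).2
      rw [descentSum_eq y ℓ (fixed_subset hXY), add_mul, Finset.sum_mul]
      congr 1
      · by_cases h : Y = X
        · subst h
          simp [hm]
        · rw [if_neg h, if_neg fun h' => h (eq_of_fixed_eq hXY h').symm, zero_mul]
      · refine Finset.sum_congr rfl fun q _ => ?_
        split_ifs <;> ring
    rw [hsplit, Finset.sum_congr rfl hexp, Finset.sum_add_distrib, Finset.sum_comm]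
    congr 1
    · simp
    · refine Finset.sum_congr rfl fun q hq => ?_
      obtain ⟨h1, h2, h3⟩ := Finset.mem_offDiag.1 hq
      obtain ⟨Z, hZ, hZY⟩ := exists_merge X h1 h2 h3
      have hmax : max q.1 q.2 ∈ fixed (rep X) := by
        rcases max_choice q.1 q.2 with h | h <;> rw [h] <;> assumption
      have hcard : #(fixed (rep Z)) = m + 1 := by
        rw [hZ, Finset.card_erase_of_mem hmax, hm]
        rfl
      rw [← hZ, ih (signedLabel q) Z hcard, Finset.mul_sum]
      by_cases h : signedLabel q ≤ ℓ
      · simp only [h, and_true, if_true]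
        rw [← Finset.sum_filter, Finset.filter_filter]
        simp only [hZY]
      · simp [h]

/-- The generating function of sequences of mergings satisfies the recursion for sums over
chains of flats. The number `n + 1` is at least every label, so that no sequence starts with an
ascent. -/
theorem mergeSum_recursion (X : (braidArrangement n).Flat) [DecidablePred (X < ·)] :
    mergeSum y u (1 + u) (#(fixed (rep X)) - 1) (n + 1) (fixed (rep X)) =
      descentSum y (n + 1) (fixed (rep X)) ⊤ +
        ∑ Y with X < Y, descentSum y (n + 1) (fixed (rep X)) Y * u *
          mergeSum y u (1 + u) (#(fixed (rep Y)) - 1) (n + 1) (fixed (rep Y)) := by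
  classical
  -- Compare a forced with an optional cut in front of a sequence; only the empty one has neither.
  have hstart : ∀ Y : (braidArrangement n).Flat,
      (1 + u) * mergeSum y u (1 + u) (#(fixed (rep Y)) - 1) (-(n + 2)) (fixed (rep Y)) =
        u * mergeSum y u (1 + u) (#(fixed (rep Y)) - 1) (n + 1) (fixed (rep Y)) +
          if Y = ⊤ then 1 else 0 := by
    intro Y
    by_cases h : Y = ⊤
    · subst h
      simp only [fixed_top, card_singleton, Nat.sub_self, mergeSum, if_true]
      ring
    · obtain ⟨k, hk⟩ : ∃ k, #(fixed (rep Y)) - 1 = k + 1 := by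
        refine Nat.exists_eq_succ_of_ne_zero ?_
        have h1 := card_fixed_pos Y
        have h2 := mt (eq_top_iff_card Y).2 h
        omega
      rw [hk, if_neg h, add_zero]
      simp only [mergeSum, neg_lt_signedLabel, (signedLabel_le _).not_gt, if_true, if_false,
        Finset.mul_sum]
      exact Finset.sum_congr rfl fun q _ => by ring
  have hcard : #(fixed (rep X)) = (#(fixed (rep X)) - 1) + 1 := by
    have := card_fixed_pos X
    omega
  have hmain := mergeSum_eq_sum_descentSum y u _ (n + 1) X hcard
  have hsum : (1 + u) * mergeSum y u (1 + u) (#(fixed (rep X)) - 1) (n + 1) (fixed (rep X)) =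
      ∑ Y with X ≤ Y, descentSum y (n + 1) (fixed (rep X)) Y * u *
        mergeSum y u (1 + u) (#(fixed (rep Y)) - 1) (n + 1) (fixed (rep Y)) +
      descentSum y (n + 1) (fixed (rep X)) ⊤ := by
    have htop : descentSum y (n + 1) (fixed (rep X)) ⊤ =
        ∑ Y with X ≤ Y, if Y = ⊤ then descentSum y (n + 1) (fixed (rep X)) Y else 0 := by
      simp
    conv_lhs => rw [hmain]
    rw [htop, ← Finset.sum_add_distrib, Finset.mul_sum]
    refine Finset.sum_congr rfl fun Y _ => ?_
    rw [mul_left_comm, hstart]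
    split_ifs <;> ring
  have hle : (univ.filter (X ≤ ·) : Finset (braidArrangement n).Flat) =
      insert X (univ.filter (X < ·)) := by
    ext Y
    simp [le_iff_eq_or_lt, eq_comm]
  rw [hle, Finset.sum_insert (by simp), descentSum_self] at hsum
  linear_combination hsum

/-- The generating function of sequences of mergings is the sum over all chains of flats. -/
theorem sum_chainSum_eq_mergeSum
    (f : (braidArrangement n).Flat → (braidArrangement n).Flat → R)
    (hf : ∀ X Y, X ≤ Y → f X Y = descentSum y (n + 1) (fixed (rep X)) Y)
    (K : ℕ) (X : (braidArrangement n).Flat) (hK : #(fixed (rep X)) ≤ K) :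
    ∑ k ∈ Finset.range K, chainSum f u k X =
      mergeSum y u (1 + u) (#(fixed (rep X)) - 1) (n + 1) (fixed (rep X)) := by
  classical
  induction K generalizing X with
  | zero => exact absurd (card_fixed_pos X) (by omega)
  | succ K ih =>
    rw [Finset.sum_range_succ', mergeSum_recursion, add_comm]
    simp only [chainSum]
    rw [Finset.sum_comm, hf X ⊤ le_top]
    congr 1
    refine Finset.sum_congr (by ext; simp) fun Y hY => ?_
    have hXY : X < Y := (Finset.mem_filter.1 hY).2
    rw [← Finset.mul_sum, ih Y (by have := card_fixed_lt hXY; omega), hf X Y hXY.le]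

end Decomposition

end BraidFlat

/-! ### Words and orders of deletion of their bars -/

namespace SetComp

open Finset BraidFlat

variable {N m : ℕ}

/-- The entries of the word `v` that no bar in `T` separates from the position `p`. -/
def wordBlock (v : Fin (m + 1) → Fin N) (T : Finset (Fin m)) (p : Fin (m + 1)) : Finset (Fin N) :=
  (univ.filter fun q => ∀ b ∈ T, ¬ Separates b p q).image v

theorem not_separates_self (b : Fin m) (p : Fin (m + 1)) : ¬ Separates b p p := by
  rintro (⟨h1, h2⟩ | ⟨h1, h2⟩) <;> exact absurd (h2.trans h1) (not_le.2 Fin.castSucc_lt_succ)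

theorem wordBlock_nonempty (v : Fin (m + 1) → Fin N) (T : Finset (Fin m)) (p : Fin (m + 1)) :
    (wordBlock v T p).Nonempty :=
  ⟨v p, Finset.mem_image_of_mem _ (Finset.mem_filter.2
    ⟨Finset.mem_univ _, fun b _ => not_separates_self b p⟩)⟩

/-- The smallest entry in the block at position `p` of the word `v` with bars at the places `T`. -/
def wordMin (v : Fin (m + 1) → Fin N) (T : Finset (Fin m)) (p : Fin (m + 1)) : Fin N :=
  (wordBlock v T p).min' (wordBlock_nonempty v T p)

theorem wordMin_le (v : Fin (m + 1) → Fin N) (T : Finset (Fin m)) (p q : Fin (m + 1))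
    (h : ∀ b ∈ T, ¬ Separates b p q) : wordMin v T p ≤ v q :=
  Finset.min'_le _ _ (Finset.mem_image_of_mem _ (Finset.mem_filter.2 ⟨Finset.mem_univ _, h⟩))

theorem exists_wordMin_eq (v : Fin (m + 1) → Fin N) (T : Finset (Fin m)) (p : Fin (m + 1)) :
    ∃ q, (∀ b ∈ T, ¬ Separates b p q) ∧ v q = wordMin v T p := by
  have h := Finset.min'_mem _ (wordBlock_nonempty v T p)
  obtain ⟨q, hq, hq'⟩ := Finset.mem_image.1 h
  exact ⟨q, (Finset.mem_filter.1 hq).2, hq'⟩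

/-- As long as all bars are present, every block is a singleton. -/
theorem wordMin_univ (v : Fin (m + 1) → Fin N) (p : Fin (m + 1)) : wordMin v univ p = v p := by
  obtain ⟨q, hq, hq'⟩ := exists_wordMin_eq v univ p
  have hpq : q = p := by
    by_contra hne
    rcases lt_or_gt_of_ne hne with h | h
    · refine hq ⟨q, by have := p.2; have : (q : ℕ) < p := h; omega⟩ (Finset.mem_univ _)
        (Or.inr ⟨le_rfl, ?_⟩)
      exact Fin.le_iff_val_le_val.2 (Nat.succ_le_of_lt h)
    · refine hq ⟨p, by have := q.2; have : (p : ℕ) < q := h; omega⟩ (Finset.mem_univ _)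
        (Or.inl ⟨le_rfl, ?_⟩)
      exact Fin.le_iff_val_le_val.2 (Nat.succ_le_of_lt h)
  rw [← hq', hpq]

/-- The word obtained from `v` by replacing the two entries next to the bar `p` by their minimum. -/
def contract (v : Fin (m + 2) → Fin N) (p : Fin (m + 1)) : Fin (m + 1) → Fin N :=
  fun q => if q = p then min (v p.castSucc) (v p.succ) else v (p.succ.succAbove q)

theorem predAbove_val (p : Fin (m + 1)) (x : Fin (m + 2)) :
    (p.predAbove x : ℕ) = if (p : ℕ) < x then (x : ℕ) - 1 else x := by
  unfold Fin.predAbove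
  by_cases h : (p : ℕ) < x
  · have h' : p.castSucc < x := h
    simp [h, h']
  · have h' : ¬ p.castSucc < x := h
    simp [h, h']

theorem succAbove_val (p : Fin (m + 1)) (b : Fin m) :
    (p.succAbove b : ℕ) = if (b : ℕ) < p then (b : ℕ) else b + 1 := by
  unfold Fin.succAbove
  by_cases h : (b : ℕ) < p
  · have h' : b.castSucc < p := h
    simp [h, h']
  · have h' : ¬ b.castSucc < p := h
    simp [h, h']

theorem separates_succAbove (p : Fin (m + 1)) (b : Fin m) (x z : Fin (m + 2)) :
    Separates (p.succAbove b) x z ↔ Separates b (p.predAbove x) (p.predAbove z) := by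
  have hb := succAbove_val p b
  have h : ∀ x : Fin (m + 2), (x ≤ (p.succAbove b).castSucc ↔ p.predAbove x ≤ b.castSucc) ∧
      ((p.succAbove b).succ ≤ x ↔ b.succ ≤ p.predAbove x) := by
    intro x
    have hx := predAbove_val p x
    simp only [Fin.le_iff_val_le_val, Fin.val_castSucc, Fin.val_succ]
    split_ifs at hb hx <;> constructor <;> omega
  unfold Separates
  rw [(h x).1, (h x).2, (h z).1, (h z).2]

theorem predAbove_castSucc_succAbove (p : Fin (m + 1)) (b : Fin m) :
    p.predAbove (p.succAbove b).castSucc = b.castSucc := by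
  ext
  have hb := succAbove_val p b
  rw [predAbove_val]
  simp only [Fin.val_castSucc]
  split_ifs at hb ⊢ <;> omega

theorem predAbove_succ_succAbove (p : Fin (m + 1)) (b : Fin m) :
    p.predAbove (p.succAbove b).succ = b.succ := by
  ext
  have hb := succAbove_val p b
  rw [predAbove_val]
  simp only [Fin.val_succ]
  split_ifs at hb ⊢ <;> omega

theorem eq_or_eq_or_predAbove (p : Fin (m + 1)) (x : Fin (m + 2)) :
    x = p.castSucc ∨ x = p.succ ∨ p.predAbove x ≠ p ∧ p.succ.succAbove (p.predAbove x) = x := by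
  simp only [Fin.ext_iff, ne_eq, succAbove_val, predAbove_val, Fin.val_castSucc, Fin.val_succ]
  split_ifs <;> omega

theorem predAbove_succAbove_succ {p q : Fin (m + 1)} :
    p.predAbove (p.succ.succAbove q) = q := by
  simp only [Fin.ext_iff, succAbove_val, predAbove_val, Fin.val_succ]
  split_ifs <;> omega

theorem contract_predAbove_le (v : Fin (m + 2) → Fin N) (p : Fin (m + 1)) (x : Fin (m + 2)) :
    contract v p (p.predAbove x) ≤ v x := by
  unfold contract
  rcases eq_or_eq_or_predAbove p x with rfl | rfl | ⟨h1, h2⟩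
  · simp
  · simp
  · rw [if_neg h1, h2]

theorem exists_contract_eq (v : Fin (m + 2) → Fin N) (p q : Fin (m + 1)) :
    ∃ x, p.predAbove x = q ∧ v x = contract v p q := by
  unfold contract
  by_cases h : q = p
  · subst h
    rcases min_choice (v q.castSucc) (v q.succ) with h | h
    · exact ⟨q.castSucc, by simp, by simp [h]⟩
    · exact ⟨q.succ, by simp, by simp [h]⟩
  · exact ⟨p.succ.succAbove q, predAbove_succAbove_succ, by simp [h]⟩

/-- If the bar `p` is absent, contraction at `p` does not change the minima of the blocks. -/
theorem wordMin_image_succAbove (v : Fin (m + 2) → Fin N) (p : Fin (m + 1)) (T : Finset (Fin m))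
    (x : Fin (m + 2)) :
    wordMin v (T.image p.succAbove) x = wordMin (contract v p) T (p.predAbove x) := by
  refine le_antisymm ?_ ?_
  · obtain ⟨q, hq, hq'⟩ := exists_wordMin_eq (contract v p) T (p.predAbove x)
    obtain ⟨z, hz, hz'⟩ := exists_contract_eq v p q
    rw [← hq', ← hz']
    refine wordMin_le _ _ _ _ fun b hb => ?_
    obtain ⟨c, hc, rfl⟩ := Finset.mem_image.1 hb
    rw [separates_succAbove, hz]
    exact hq c hc
  · obtain ⟨z, hz, hz'⟩ := exists_wordMin_eq v (T.image p.succAbove) x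
    rw [← hz']
    refine (wordMin_le _ _ _ (p.predAbove z) fun b hb => ?_).trans (contract_predAbove_le v p z)
    rw [← separates_succAbove]
    exact hz _ (Finset.mem_image_of_mem _ hb)

/-- The order of deletion that starts with the bar `p` and continues with `σ`, where the remaining
bars are renumbered. -/
noncomputable def consPerm (p : Fin (m + 1)) (σ : Equiv.Perm (Fin m)) : Equiv.Perm (Fin (m + 1)) :=
  Equiv.ofBijective (Fin.cons p fun i => p.succAbove (σ i) : Fin (m + 1) → Fin (m + 1))
    (Finite.injective_iff_bijective.1 (Fin.cons_injective_iff.2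
      ⟨by rintro ⟨i, hi⟩; exact Fin.succAbove_ne p _ hi,
        (Fin.succAbove_right_injective).comp σ.injective⟩))

@[simp] theorem consPerm_zero (p : Fin (m + 1)) (σ : Equiv.Perm (Fin m)) :
    consPerm p σ 0 = p := rfl

@[simp] theorem consPerm_succ (p : Fin (m + 1)) (σ : Equiv.Perm (Fin m)) (i : Fin m) :
    consPerm p σ i.succ = p.succAbove (σ i) := rfl

theorem consPerm_bijective :
    Function.Bijective fun x : Fin (m + 1) × Equiv.Perm (Fin m) => consPerm x.1 x.2 := by
  rw [Fintype.bijective_iff_injective_and_card]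
  constructor
  · rintro ⟨p, σ⟩ ⟨p', σ'⟩ h
    have hp : p = p' := by simpa using Equiv.congr_fun h 0
    subst hp
    refine Prod.ext rfl (Equiv.ext fun i => ?_)
    have := Equiv.congr_fun h i.succ
    simpa using this
  · simp [Fintype.card_perm, Nat.factorial_succ]

theorem bars_zero (σ : Equiv.Perm (Fin (m + 1))) : bars σ 0 = univ := by
  ext b
  simp only [bars, Finset.mem_image, Finset.mem_Ici, Finset.mem_univ, iff_true]
  exact ⟨σ.symm b, Fin.zero_le _, by simp⟩

theorem bars_consPerm_succ (p : Fin (m + 1)) (σ : Equiv.Perm (Fin m)) (i : Fin m) :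
    bars (consPerm p σ) i.succ = (bars σ i).image p.succAbove := by
  ext b
  simp only [bars, Finset.mem_image, Finset.mem_Ici, Finset.image_image, Function.comp]
  constructor
  · rintro ⟨j, hj, rfl⟩
    induction j using Fin.cases with
    | zero => exact absurd hj (not_le.2 (Fin.succ_pos i))
    | succ j => exact ⟨j, Fin.succ_le_succ_iff.1 hj, rfl⟩
  · rintro ⟨j, hj, rfl⟩
    exact ⟨j.succ, Fin.succ_le_succ_iff.2 hj, rfl⟩

/-- The minima of the two blocks that are merged in the `i`-th step. -/
def mergedMins (v : Fin (m + 1) → Fin N) (σ : Equiv.Perm (Fin m)) (i : Fin m) : Fin N × Fin N :=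
  (wordMin v (bars σ i) (σ i).castSucc, wordMin v (bars σ i) (σ i).succ)

theorem mergedMins_zero (v : Fin (m + 2) → Fin N) (p : Fin (m + 1)) (σ : Equiv.Perm (Fin m)) :
    mergedMins v (consPerm p σ) 0 = (v p.castSucc, v p.succ) := by
  simp [mergedMins, bars_zero, wordMin_univ]

theorem mergedMins_succ (v : Fin (m + 2) → Fin N) (p : Fin (m + 1)) (σ : Equiv.Perm (Fin m))
    (i : Fin m) : mergedMins v (consPerm p σ) i.succ = mergedMins (contract v p) σ i := by
  simp only [mergedMins, bars_consPerm_succ, consPerm_succ, wordMin_image_succAbove,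
    predAbove_castSucc_succAbove, predAbove_succ_succAbove]

section Weight

variable {n : ℕ} {R : Type*} [CommRing R] (y t : R)

/-- The monomial of a word with an order of deletion: a factor `y` for each positive label and a
factor `t` for each label that is larger than the preceding one, where the label before the first
one is taken to be `ℓ`. -/
def weight (ℓ : ℤ) (v : Fin (m + 1) → Fin (n + 1)) (σ : Equiv.Perm (Fin m)) : R :=
  ∏ i : Fin m, (if (mergedMins v σ i).1 < (mergedMins v σ i).2 then y else 1) *
    (if (Fin.cons ℓ (fun j => signedLabel (mergedMins v σ j)) : Fin (m + 1) → ℤ) i.castSucc <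
      signedLabel (mergedMins v σ i) then t else 1)

theorem weight_consPerm (ℓ : ℤ) (v : Fin (m + 2) → Fin (n + 1)) (p : Fin (m + 1))
    (σ : Equiv.Perm (Fin m)) :
    weight y t ℓ v (consPerm p σ) = (if v p.castSucc < v p.succ then y else 1) *
      ((if ℓ < signedLabel (v p.castSucc, v p.succ) then t else 1) *
        weight y t (signedLabel (v p.castSucc, v p.succ)) (contract v p) σ) := by
  rw [weight, Fin.prod_univ_succ, mergedMins_zero]
  simp only [mergedMins_succ]
  rw [mul_assoc]
  congr 2
  refine Finset.prod_congr rfl fun i _ => ?_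
  congr 3
  change signedLabel (mergedMins v (consPerm p σ) i.castSucc) = _
  generalize i.castSucc = j
  induction j using Fin.cases with
  | zero => rw [mergedMins_zero, Fin.cons_zero]
  | succ j => rw [mergedMins_succ, Fin.cons_succ]

theorem injective_of_card_image {v : Fin m → Fin N} (h : #(univ.image v) = m) :
    Function.Injective v := by
  have h' : Set.InjOn v (univ : Finset (Fin m)) :=
    Finset.injOn_of_card_image_eq (by rw [h, Finset.card_univ, Fintype.card_fin])
  exact fun a b hab => h' (by simp) (by simp) hab

theorem succ_succAbove_ne_castSucc {p j : Fin (m + 1)} (h : j ≠ p) :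
    p.succ.succAbove j ≠ p.castSucc := by
  intro h'
  apply h
  rw [← predAbove_succAbove_succ (p := p) (q := j), h']
  simp

theorem image_contract {M : Finset (Fin N)} {v : Fin (m + 2) → Fin N} (hv : univ.image v = M)
    (hinj : Function.Injective v) (p : Fin (m + 1)) :
    univ.image (contract v p) = M.erase (max (v p.castSucc) (v p.succ)) := by
  have hne : v p.castSucc ≠ v p.succ := fun h => Fin.castSucc_lt_succ.ne (hinj h)
  ext c
  rw [Finset.mem_erase, ← hv]
  simp only [Finset.mem_image, Finset.mem_univ, true_and]
  constructor
  · rintro ⟨j, rfl⟩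
    refine ⟨?_, ?_⟩
    · unfold contract
      split_ifs with h
      · exact (min_lt_max.2 hne).ne
      · rcases max_choice (v p.castSucc) (v p.succ) with h' | h' <;> rw [h']
        · exact fun h'' => succ_succAbove_ne_castSucc h (hinj h'')
        · exact fun h'' => Fin.succAbove_ne _ _ (hinj h'')
    · obtain ⟨z, -, hz⟩ := exists_contract_eq v p j
      exact ⟨z, hz⟩
  · rintro ⟨h, z, rfl⟩
    rcases eq_or_eq_or_predAbove p z with rfl | rfl | ⟨h1, h2⟩
    · refine ⟨p, ?_⟩
      rw [contract, if_pos rfl, min_eq_left]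
      exact le_of_not_ge fun h' => h (max_eq_left h').symm
    · refine ⟨p, ?_⟩
      rw [contract, if_pos rfl, min_eq_right]
      exact le_of_not_ge fun h' => h (max_eq_right h').symm
    · exact ⟨p.predAbove z, by rw [contract, if_neg h1, h2]⟩

/-- Inserting the entries `q` at a bar is inverse to contraction. -/
theorem exists_contract {M : Finset (Fin N)} {q : Fin N × Fin N} (hq : q ∈ M.offDiag)
    {c : Fin (m + 1) → Fin N} (hc : univ.image c = M.erase (max q.1 q.2)) :
    ∃ (v : Fin (m + 2) → Fin N) (p : Fin (m + 1)), univ.image v = M ∧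
      (v p.castSucc, v p.succ) = q ∧ contract v p = c := by
  obtain ⟨h1, h2, h3⟩ := Finset.mem_offDiag.1 hq
  have hmin : min q.1 q.2 ∈ M.erase (max q.1 q.2) := by
    refine Finset.mem_erase.2 ⟨(min_lt_max.2 h3).ne, ?_⟩
    rcases min_choice q.1 q.2 with h | h <;> rw [h] <;> assumption
  rw [← hc] at hmin
  obtain ⟨p, -, hp⟩ := Finset.mem_image.1 hmin
  let v : Fin (m + 2) → Fin N := fun x =>
    if x = p.castSucc then q.1 else if x = p.succ then q.2 else c (p.predAbove x)
  have hv1 : v p.castSucc = q.1 := if_pos rfl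
  have hv2 : v p.succ = q.2 := by
    simp only [v, if_neg Fin.castSucc_lt_succ.ne', if_true]
  have hv3 : ∀ j, j ≠ p → v (p.succ.succAbove j) = c j := by
    intro j hj
    simp only [v, if_neg (succ_succAbove_ne_castSucc hj), if_neg (Fin.succAbove_ne _ _),
      predAbove_succAbove_succ]
  have hcM : ∀ j, c j ∈ M := fun j => Finset.mem_of_mem_erase
    (hc ▸ Finset.mem_image_of_mem c (Finset.mem_univ j))
  refine ⟨v, p, ?_, Prod.ext hv1 hv2, funext fun j => ?_⟩
  · ext a
    simp only [Finset.mem_image, Finset.mem_univ, true_and]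
    constructor
    · rintro ⟨x, rfl⟩
      simp only [v]
      split_ifs
      exacts [h1, h2, hcM _]
    · intro ha
      by_cases ha1 : a = q.1
      · exact ⟨_, hv1.trans ha1.symm⟩
      by_cases ha2 : a = q.2
      · exact ⟨_, hv2.trans ha2.symm⟩
      have hamax : a ≠ max q.1 q.2 := by
        rcases max_choice q.1 q.2 with h | h <;> rw [h] <;> assumption
      have hamin : a ≠ min q.1 q.2 := by
        rcases min_choice q.1 q.2 with h | h <;> rw [h] <;> assumption
      have hac := Finset.mem_erase.2 ⟨hamax, ha⟩
      rw [← hc] at hac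
      obtain ⟨j, -, rfl⟩ := Finset.mem_image.1 hac
      exact ⟨p.succ.succAbove j, hv3 j fun h => hamin (by rw [h, hp])⟩
  · unfold contract
    split_ifs with h
    · rw [h, hv1, hv2, hp]
    · exact hv3 j h

/-- A word with a marked bar is determined by the entries `q` next to the bar and by the contracted
word, in which the bar is recovered as the position of the minimum of `q`. -/
theorem sum_contract (M : Finset (Fin (n + 1))) (hM : #M = m + 2)
    (g : Fin (n + 1) × Fin (n + 1) → (Fin (m + 1) → Fin (n + 1)) → R) :
    ∑ v : Fin (m + 2) → Fin (n + 1) with univ.image v = M, ∑ p : Fin (m + 1),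
        g (v p.castSucc, v p.succ) (contract v p) =
      ∑ q ∈ M.offDiag, ∑ v : Fin (m + 1) → Fin (n + 1) with univ.image v = M.erase (max q.1 q.2),
        g q v := by
  rw [← Finset.sum_product', Finset.sum_sigma']
  have hinj : ∀ v : Fin (m + 2) → Fin (n + 1), univ.image v = M → Function.Injective v :=
    fun v hv => injective_of_card_image (by rw [hv, hM])
  have hmem : ∀ (v : Fin (m + 2) → Fin (n + 1)) (p : Fin (m + 1)), univ.image v = M →
      (v p.castSucc, v p.succ) ∈ M.offDiag := by
    intro v p hv
    have hvM : ∀ x, v x ∈ M := fun x => hv ▸ Finset.mem_image_of_mem v (Finset.mem_univ x)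
    exact Finset.mem_offDiag.2
      ⟨hvM _, hvM _, fun h => Fin.castSucc_lt_succ.ne (hinj v hv h)⟩
  refine Finset.sum_bij (fun x _ => ⟨(x.1 x.2.castSucc, x.1 x.2.succ), contract x.1 x.2⟩)
    ?_ ?_ ?_ ?_
  · rintro ⟨v, p⟩ hx
    simp only [Finset.mem_product, Finset.mem_filter, Finset.mem_univ, true_and, and_true] at hx
    exact Finset.mem_sigma.2 ⟨hmem v p hx, by simpa using image_contract hx (hinj v hx) p⟩
  · rintro ⟨v, p⟩ hx ⟨v', p'⟩ hx' h
    simp only [Finset.mem_product, Finset.mem_filter, Finset.mem_univ, true_and, and_true] at hx hx'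
    simp only [Sigma.mk.injEq, Prod.mk.injEq, heq_eq_eq] at h
    obtain ⟨⟨h1, h2⟩, h3⟩ := h
    have hc : Function.Injective (contract v p) := by
      refine injective_of_card_image ?_
      obtain ⟨h4, h5, -⟩ := Finset.mem_offDiag.1 (hmem v p hx)
      have hmax : max (v p.castSucc) (v p.succ) ∈ M := by
        rcases max_choice (v p.castSucc) (v p.succ) with h | h <;> rw [h] <;> assumption
      rw [image_contract hx (hinj v hx) p, Finset.card_erase_of_mem hmax, hM]
      rfl
    have hp : p = p' := by
      apply hc
      conv_rhs => rw [h3]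
      simp only [contract, if_true, h1, h2]
    subst hp
    refine Prod.ext (funext fun x => ?_) rfl
    rcases eq_or_eq_or_predAbove p x with rfl | rfl | ⟨h4, h5⟩
    · exact h1
    · exact h2
    · have := congrFun h3 (p.predAbove x)
      simpa only [contract, if_neg h4, h5] using this
  · rintro ⟨q, c⟩ hx
    obtain ⟨hq, hc⟩ := Finset.mem_sigma.1 hx
    obtain ⟨v, p, hv, rfl, rfl⟩ := exists_contract hq (Finset.mem_filter.1 hc).2
    exact ⟨(v, p), by simp [hv], rfl⟩
  · rintro ⟨v, p⟩ _
    rfl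

/-- Words with an order of deletion of their bars are in bijection with sequences of mergings of
their entries, by induction on the length: the first merging is given by the two entries next to the
first deleted bar, and the remaining ones come from the contracted word. -/
theorem sum_weight_eq_mergeSum (m : ℕ) (ℓ : ℤ) (M : Finset (Fin (n + 1))) (hM : #M = m + 1) :
    ∑ v : Fin (m + 1) → Fin (n + 1) with univ.image v = M, ∑ σ : Equiv.Perm (Fin m),
      weight y t ℓ v σ = mergeSum y t 1 m ℓ M := by
  induction m generalizing ℓ M with
  | zero =>
    obtain ⟨a, rfl⟩ := Finset.card_eq_one.1 hM
    rw [Finset.sum_eq_single_of_mem (fun _ => a)]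
    · simp [weight, mergeSum]
    · refine Finset.mem_filter.2 ⟨Finset.mem_univ _, ?_⟩
      ext
      simp [eq_comm]
    · intro v hv hne
      refine absurd (funext fun i => ?_) hne
      rw [← Finset.mem_singleton, ← (Finset.mem_filter.1 hv).2]
      exact Finset.mem_image_of_mem v (Finset.mem_univ i)
  | succ m ih =>
    have h : ∀ v : Fin (m + 2) → Fin (n + 1), ∑ σ : Equiv.Perm (Fin (m + 1)), weight y t ℓ v σ =
        ∑ p : Fin (m + 1), ∑ σ : Equiv.Perm (Fin m), weight y t ℓ v (consPerm p σ) := by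
      intro v
      rw [← Fintype.sum_prod_type',
        consPerm_bijective.sum_comp (fun σ => weight y t ℓ v σ)]
    simp only [h, weight_consPerm, ← Finset.mul_sum]
    rw [sum_contract M hM fun q v => (if q.1 < q.2 then y else 1) *
      ((if ℓ < signedLabel q then t else 1) *
        ∑ σ : Equiv.Perm (Fin m), weight y t (signedLabel q) v σ)]
    simp only [mergeSum]
    refine Finset.sum_congr rfl fun q hq => ?_
    obtain ⟨h1, h2, h3⟩ := Finset.mem_offDiag.1 hq
    have hmax : max q.1 q.2 ∈ M := by
      rcases max_choice q.1 q.2 with h | h <;> rw [h] <;> assumption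
    rw [← ih (signedLabel q) _ (by rw [Finset.card_erase_of_mem hmax, hM]; rfl), Finset.mul_sum,
      Finset.mul_sum]

end Weight

end SetComp

/-! ### The numerator of the braid arrangement -/

namespace SetComp

open Finset BraidFlat

variable {n : ℕ} {R : Type*} [CommRing R] (y t : R)

/-- A label preceding the sequence that is at least as large as all its terms adds no ascent. -/
theorem pow_asc (a : Fin n → ℤ) (ℓ : ℤ) (hℓ : ∀ i, a i ≤ ℓ) :
    t ^ asc a = ∏ i : Fin n,
      if (Fin.cons ℓ a : Fin (n + 1) → ℤ) i.castSucc < a i then t else 1 := by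
  rw [asc, ← Finset.prod_const, Finset.prod_filter]
  cases n with
  | zero => rfl
  | succ n =>
    rw [Fin.prod_univ_castSucc, Fin.prod_univ_succ, mul_comm]
    congr 1
    · simp [(hℓ 0).not_gt]
    · refine Finset.prod_congr rfl fun i _ => ?_
      have h : (i : ℕ) + 1 < n + 1 := by omega
      have h1 : (∃ h : ((i.castSucc : Fin (n + 1)) : ℕ) + 1 < n + 1,
          a i.castSucc < a ⟨i.castSucc + 1, h⟩) ↔ a i.castSucc < a i.succ :=
        ⟨fun ⟨_, h'⟩ => h', fun h' => ⟨h, h'⟩⟩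
      simp only [h1]
      rfl

theorem weight_eq (w : Equiv.Perm (Fin (n + 1))) (σ : Equiv.Perm (Fin n)) :
    weight y t (n + 1) w σ = y ^ ino w σ * t ^ asc (label w σ) := by
  have hlabel : (fun j => signedLabel (mergedMins w σ j)) = label w σ := rfl
  rw [weight, Finset.prod_mul_distrib, hlabel,
    pow_asc t (label w σ) (n + 1) fun i => signedLabel_le (mergedMins w σ i),
    ino, ← Finset.prod_const, Finset.prod_filter]
  rfl

theorem sum_perm_eq_mergeSum :
    ∑ w : Equiv.Perm (Fin (n + 1)), ∑ σ : Equiv.Perm (Fin n),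
      y ^ ino w σ * t ^ asc (label w σ) =
        mergeSum y t 1 n (n + 1) (univ : Finset (Fin (n + 1))) := by
  rw [← sum_weight_eq_mergeSum y t n (n + 1) univ (by simp)]
  simp only [← weight_eq]
  refine Finset.sum_bij (fun w _ => ⇑w) ?_ ?_ ?_ ?_
  · intro w _
    simp
  · intro w _ w' _ h
    exact DFunLike.coe_injective h
  · intro v hv
    have hsurj : Function.Surjective v := by
      intro a
      have ha : a ∈ univ.image v := by
        rw [(Finset.mem_filter.1 hv).2]
        exact Finset.mem_univ a
      obtain ⟨i, -, hi⟩ := Finset.mem_image.1 ha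
      exact ⟨i, hi⟩
    exact ⟨Equiv.ofBijective v (Finite.surjective_iff_bijective.1 hsurj), Finset.mem_univ _, rfl⟩
  · intro w _
    rfl

end SetComp

theorem finrank_braidSpace (n : ℕ) : Module.finrank ℝ (braidSpace n) = n := by
  have h := BraidFlat.finrank_space_add_one (⊥ : (braidArrangement n).Flat)
  rw [BraidFlat.fixed_bot, Finset.card_univ, Fintype.card_fin] at h
  have h' : Module.finrank ℝ ((⊥ : (braidArrangement n).Flat).space) =
      Module.finrank ℝ (braidSpace n) := finrank_top ℝ _
  omega

theorem one_sub_algebraMap_t_ne_zero :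
    (1 - algebraMap (MvPolynomial (Fin 2) ℤ) EssentialArrangement.RatField
      EssentialArrangement.t) ≠ 0 := by
  rw [← map_one (algebraMap (MvPolynomial (Fin 2) ℤ) EssentialArrangement.RatField), ← map_sub,
    Ne, FaithfulSMul.algebraMap_eq_zero_iff, sub_eq_zero]
  intro h
  have := congrArg (MvPolynomial.eval (fun _ => (0 : ℤ))) h
  simp at this

theorem mainTheorem2 (n : ℕ) :
    (braidArrangement n).numerator =
      algebraMap (MvPolynomial (Fin 2) ℤ) EssentialArrangement.RatField
        (∑ w : Equiv.Perm (Fin (n + 1)), ∑ σ : Equiv.Perm (Fin n),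
          EssentialArrangement.y ^ SetComp.ino w σ *
            EssentialArrangement.t ^ SetComp.asc (SetComp.label w σ)) := by
  have ht := one_sub_algebraMap_t_ne_zero
  rw [SetComp.sum_perm_eq_mergeSum, BraidFlat.map_mergeSum, map_one, EssentialArrangement.numerator,
    finrank_braidSpace]
  set φ := algebraMap (MvPolynomial (Fin 2) ℤ) EssentialArrangement.RatField
  set u := φ EssentialArrangement.t / (1 - φ EssentialArrangement.t) with hu
  have h1 : (1 - φ EssentialArrangement.t) * u = φ EssentialArrangement.t := by
    rw [hu]
    field_simp
  have h2 : (1 - φ EssentialArrangement.t) * (1 + u) = 1 := by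
    linear_combination h1
  have hscale := BraidFlat.mergeSum_mul (φ EssentialArrangement.y) u (1 + u)
    (1 - φ EssentialArrangement.t) n (n + 1) (Finset.univ : Finset (Fin (n + 1)))
  rw [h1, h2] at hscale
  have hcard : (Finset.univ : Finset (Fin (n + 1))).card = n + 1 := by simp
  -- The bound exceeds both the number of flats and the number of block minima of the bottom flat.
  rw [(braidArrangement n).cfHP_eq_sum_chainSum _ (Nat.lt_succ_of_le (Nat.le_add_right _ (n + 1))),
    BraidFlat.sum_chainSum_eq_mergeSum (φ EssentialArrangement.y) u, BraidFlat.fixed_bot, hcard,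
    hscale]
  · rfl
  · intro X Y hXY
    rw [BraidFlat.poin_eq hXY, BraidFlat.descentSum_top, map_prod]
    simp [φ]
  · rw [BraidFlat.fixed_bot, hcard]
    omega
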